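/- **Model.** Let $\tau\in[0,1]$ and, for each $n\ge 1$, let $r_s=r_s(n)$ and $r_d=r_d(n)$ be reals with $0\le r_d\le r_s\le 1/2$. Let $V_1\subseteq\{1,\dots,n\}$ have $\tau n$ elements (a nearest integer to $\tau n$ if $\tau n$ is not an integer), and let $V_2$ be its complement. Let $X_1,\dots,X_n$ be independent and uniform on $[0,1]$. The geometric block model $\mathcal G_n(r_s,r_d)$ is the random graph on $\{1,\dots,n\}$ in which distinct $i,j$ are adjacent iff $\min\{|X_i-X_j|,\,1-|X_i-X_j|\}$ is at most $r_s$ if $i,j$ lie in the same one of the sets $V_1,V_2$, and at most $r_d$ otherwise. With $A$ the adjacency matrix and $d_i=\sum_j A_{ij}$, the average clustering coefficient is $$\overline{\mathcal C}_n=\frac1n\sum_{i=1}^n\frac{\sum_{j\ne k}A_{ij}A_{jk}A_{ki}}{d_i(d_i-1)},$$ where the terms with $d_i\in\{0,1\}$ are zero. **Statement.** Suppose $r_s=\lambda r_d$ for a constant $\lambda\ge 1$, $n r_s\to\infty$ as $n\to\infty$, and $r_s\le 1/3$ for all sufficiently large $n$. Then $\overline{\mathcal C}_n\to h(\lambda,\tau)$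 in probability, where for $1\le\lambda<2$ $$h(\lambda,\tau)=\frac{\tau[3\tau^2\lambda^2+(4\lambda-\lambda^2)(1-\tau^2)]}{4(\tau\lambda+1-\tau)^2}+\frac{(1-\tau)[3(1-\tau)^2\lambda^2+(4\lambda-\lambda^2)\tau(2-\tau)]}{4((1-\tau)\lambda+\tau)^2},$$ and for $\lambda\ge 2$ $$h(\lambda,\tau)=\frac{\tau[3\tau^2\lambda^2+4(1-\tau^2)]}{4(\lambda\tau+1-\tau)^2}+\frac{(1-\tau)[3(1-\tau)^2\lambda^2+4\tau(2-\tau)]}{4(\tau+(1-\tau)\lambda)^2}.$$ Moreover, $h$ generally differs from the function $g$ given by $$g(\lambda,\tau)=\frac{[3-9\tau(1-\tau)]\lambda^2+\tau(1-\tau)\,c(\lambda)}{[4-12\tau(1-\tau)]\lambda^2+8\tau(1-\tau)\lambda+4\tau(1-\tau)},\qquad c(\lambda)=\begin{cases}3(4\lambda-\lambda^2),&1\le\lambda<2,\\ 12,&\lambda\ge2,\end{cases}$$ (the limit of the global clustering coefficient) in the following sense: for every fixed $\lambda>1$, the equality $h(\lambda,\tau)=g(\lambda,\tau)$ holds for only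 finitely many $\tau\in[0,1]$. -/

import Mathlib

open Filter Topology MeasureTheory ProbabilityTheory

/-- The periodic distance `min {|x - y|, 1 - |x - y|}` on the unit interval. -/
noncomputable def circDist (x y : ℝ) : ℝ := min |x - y| (1 - |x - y|)

theorem circDist_comm (x y : ℝ) : circDist x y = circDist y x := by
  unfold circDist
  rw [abs_sub_comm]

/-- The graph of the geometric block model on the vertex set `Fin n` with community `V₁`
(the other community is its complement) and vertex positions `x`: two distinct vertices are
adjacent iff their periodic distance is at most `r_s` if they are in the same community,
and at most `r_d` otherwise. -/
noncomputable def gbmGraph {n : ℕ} (rs rd : ℝ) (V₁ : Finset (Fin n)) (x : Fin n → ℝ) :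
    SimpleGraph (Fin n) where
  Adj i j := i ≠ j ∧
    circDist (x i) (x j) ≤ rd + (rs - rd) * (if (i ∈ V₁ ↔ j ∈ V₁) then 1 else 0)
  symm := ⟨fun i j h => by
    refine ⟨h.1.symm, ?_⟩
    have h2 := h.2
    rw [circDist_comm] at h2
    simpa only [iff_comm (a := j ∈ V₁)] using h2⟩
  loopless := ⟨fun _ h => h.1 rfl⟩

open Classical in
/-- The average clustering coefficient of a graph on `Fin n`: the average over all vertices `i`
of `∑_{j ≠ k} A_ij A_jk A_ki / (d_i (d_i - 1))`, terms with `d_i ∈ {0, 1}` being zero. -/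
noncomputable def avgClustering {n : ℕ} (G : SimpleGraph (Fin n)) : ℝ :=
  (1 / (n : ℝ)) * ∑ i : Fin n,
    if 2 ≤ G.degree i then
      (∑ j : Fin n, ∑ k : Fin n,
        if j ≠ k then G.adjMatrix ℝ i j * G.adjMatrix ℝ j k * G.adjMatrix ℝ k i else 0) /
        ((G.degree i : ℝ) * ((G.degree i : ℝ) - 1))
    else 0

/-- The limit function of the average clustering coefficient (for `lam ≥ 1`). -/
noncomputable def hLim (lam τ : ℝ) : ℝ :=
  if lam < 2 then
    τ * (3 * τ ^ 2 * lam ^ 2 + (4 * lam - lam ^ 2) * (1 - τ ^ 2)) /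
        (4 * (τ * lam + 1 - τ) ^ 2) +
      (1 - τ) * (3 * (1 - τ) ^ 2 * lam ^ 2 + (4 * lam - lam ^ 2) * τ * (2 - τ)) /
        (4 * ((1 - τ) * lam + τ) ^ 2)
  else
    τ * (3 * τ ^ 2 * lam ^ 2 + 4 * (1 - τ ^ 2)) / (4 * (lam * τ + 1 - τ) ^ 2) +
      (1 - τ) * (3 * (1 - τ) ^ 2 * lam ^ 2 + 4 * τ * (2 - τ)) /
        (4 * (τ + (1 - τ) * lam) ^ 2)

/-- The limit function of the global clustering coefficient (for `lam ≥ 1`). -/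
noncomputable def gLim (lam τ : ℝ) : ℝ :=
  if lam < 2 then
    ((3 - 9 * τ * (1 - τ)) * lam ^ 2 + 3 * τ * (1 - τ) * (4 * lam - lam ^ 2)) /
      ((4 - 12 * τ * (1 - τ)) * lam ^ 2 + 8 * τ * (1 - τ) * lam + 4 * τ * (1 - τ))
  else
    ((3 - 9 * τ * (1 - τ)) * lam ^ 2 + 12 * τ * (1 - τ)) /
      ((4 - 12 * τ * (1 - τ)) * lam ^ 2 + 8 * τ * (1 - τ) * lam + 4 * τ * (1 - τ))

/-! Seen from a vertex `i`, the differences X_j − X_i on the circle ℝ/ℤ are again independent and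
uniform. So the degree d and the triangle count T at `i` are sums, over vertices and over ordered
pairs respectively, of functions of independent variables. Put x = n r_d, which tends to infinity.
The mean of d is of order x with Var d ≤ E d, and T fluctuates by O(x^{3/2})
(`variance_sum_offDiag_le`). Hence the local coefficient T / (d (d − 1)) is within O(x^{-1/2}) in
mean of E T / (E d)², uniformly in `i` (`integral_abs_localClustering_sub_le`). An L¹ bound can be
averaged over `i` although different vertices are dependent, and Markov's inequality turns it into
convergence in probability.

The ratio of means is planar geometry. A triple inside one community forms a triangle, given one of
its positions, with probability 3 r_s². In a mixed triple exactly one pair has radius r_s and two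
have r_d, which gives κ r_d² (`triangleProb_radius`); r_s ≤ 1/3 keeps triangles from winding around
the circle. If the community of `i` has proportion s, the ratio tends to `localLim`, and weighting
the two communities gives h (`hLim_eq`).

For the comparison with g, fix λ > 1. Both functions are rational in τ, and h has a pole at τ =
−1/(λ − 1), outside [0,1], where the denominator of g does not vanish. The polynomial obtained by
clearing denominators is therefore nonzero and has finitely many roots. -/

/-! ### The limit functions h and g, and their coincidences -/

/-- The coefficient `κ` such that `κ r_d²` is the probability that a vertex triple meeting both
communities forms a triangle through a fixed position of one of its vertices. -/
noncomputable def mixedCoeff (lam : ℝ) : ℝ := if lam < 2 then 4 * lam - lam ^ 2 else 4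

/-- The limit of the local clustering coefficient of a vertex whose community has
asymptotic proportion `s`. -/
noncomputable def localLim (lam s : ℝ) : ℝ :=
  ((3 * lam ^ 2 - mixedCoeff lam) * s ^ 2 + mixedCoeff lam) / (4 * (lam * s + (1 - s)) ^ 2)

theorem hLim_eq (lam τ : ℝ) :
    hLim lam τ = τ * localLim lam τ + (1 - τ) * localLim lam (1 - τ) := by
  unfold hLim localLim mixedCoeff
  split_ifs
  · rw [← mul_div_assoc, ← mul_div_assoc]
    congr 2 <;> ring
  · rw [← mul_div_assoc, ← mul_div_assoc]
    congr 2 <;> ring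

theorem gLim_eq (lam τ : ℝ) :
    gLim lam τ = ((3 - 9 * τ * (1 - τ)) * lam ^ 2 + 3 * τ * (1 - τ) * mixedCoeff lam) /
      (4 * lam ^ 2 - 4 * (τ * (1 - τ)) * ((3 * lam + 1) * (lam - 1))) := by
  unfold gLim mixedCoeff
  split_ifs <;> congr 1 <;> ring

/-- This is (λ − 1)² times the numerator of `localLim` at s = −1/(λ − 1), the zero of its
denominator; being nonzero, it makes that point a genuine pole. -/
theorem localLim_numerator_pole_ne_zero {lam : ℝ} (h : 1 < lam) :
    3 * lam ^ 2 + mixedCoeff lam * (lam * (lam - 2)) ≠ 0 := by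
  have hl : 0 < lam := by linarith
  unfold mixedCoeff
  split_ifs with h2
  · have : 3 * lam ^ 2 + (4 * lam - lam ^ 2) * (lam * (lam - 2))
        = lam ^ 2 * ((lam - 1) * (5 - lam)) := by ring
    rw [this]
    have : 0 < lam - 1 := by linarith
    have : 0 < 5 - lam := by linarith
    positivity
  · have : 0 ≤ lam - 2 := by linarith
    positivity

theorem finite_hLim_eq_gLim {lam : ℝ} (h : 1 < lam) :
    {τ : ℝ | τ ∈ Set.Icc (0 : ℝ) 1 ∧ hLim lam τ = gLim lam τ}.Finite := by
  set κ := mixedCoeff lam with hκ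
  -- `A` and `B` are the denominators of the two community terms up to the factor 4 and squaring,
  -- `NA` and `NB` their weighted numerators; `G` and `D` are numerator and denominator of g. `Q` is
  -- the equation h = g with denominators cleared.
  open Polynomial in
  let A : ℝ[X] := C lam * X + (1 - X)
  open Polynomial in
  let B : ℝ[X] := C lam * (1 - X) + X
  open Polynomial in
  let D : ℝ[X] := C (4 * lam ^ 2) - C 4 * (X * (1 - X)) * C ((3 * lam + 1) * (lam - 1))
  open Polynomial in
  let NA : ℝ[X] := X * (C (3 * lam ^ 2 - κ) * X ^ 2 + C κ)
  open Polynomial in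
  let NB : ℝ[X] := (1 - X) * (C (3 * lam ^ 2 - κ) * (1 - X) ^ 2 + C κ)
  open Polynomial in
  let G : ℝ[X] := C (lam ^ 2) * (C 3 - C 9 * X * (1 - X)) + C 3 * X * (1 - X) * C κ
  open Polynomial in
  let Q : ℝ[X] := (NA * B ^ 2 + NB * A ^ 2) * D - C 4 * G * A ^ 2 * B ^ 2
  have hl1 : 0 < lam - 1 := by linarith
  have hQ : Q ≠ 0 := by
    intro h0
    -- At the zero of `A` only the product NA · B² · D survives in `Q`, and each factor is nonzero
    -- there.
    have h1 : Q.eval (-1 / (lam - 1)) = 0 := by rw [h0, Polynomial.eval_zero]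
    have hA : A.eval (-1 / (lam - 1)) = 0 := by
      simp only [A, Polynomial.eval_add, Polynomial.eval_mul, Polynomial.eval_C,
        Polynomial.eval_X, Polynomial.eval_sub, Polynomial.eval_one]
      field_simp
      ring
    have hB : B.eval (-1 / (lam - 1)) = lam + 1 := by
      simp only [B, Polynomial.eval_add, Polynomial.eval_mul, Polynomial.eval_C,
        Polynomial.eval_X, Polynomial.eval_sub, Polynomial.eval_one]
      field_simp
      ring
    have hD : D.eval (-1 / (lam - 1)) = 4 * lam ^ 2 + 4 * lam * (3 * lam + 1) / (lam - 1) := by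
      simp only [D, Polynomial.eval_mul, Polynomial.eval_C,
        Polynomial.eval_X, Polynomial.eval_sub, Polynomial.eval_one]
      field_simp
      ring
    have hN : NA.eval (-1 / (lam - 1))
        = -1 / (lam - 1) ^ 3 * (3 * lam ^ 2 + κ * (lam * (lam - 2))) := by
      simp only [NA, Polynomial.eval_mul, Polynomial.eval_C, Polynomial.eval_add,
        Polynomial.eval_X, Polynomial.eval_pow]
      field_simp
      ring
    simp only [Q, Polynomial.eval_mul, Polynomial.eval_add, Polynomial.eval_sub,
      Polynomial.eval_pow, hA, hB, hD, hN] at h1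
    have h2 := localLim_numerator_pole_ne_zero h
    have h3 : (lam + 1) ^ 2 ≠ 0 := by positivity
    have h4 : 4 * lam ^ 2 + 4 * lam * (3 * lam + 1) / (lam - 1) ≠ 0 := by positivity
    have h5 : -1 / (lam - 1) ^ 3 ≠ 0 := div_ne_zero (by norm_num) (by positivity)
    refine mul_ne_zero (mul_ne_zero (mul_ne_zero h5 h2) h3) h4 ?_
    linear_combination h1
  refine (Q.roots.toFinset.finite_toSet).subset ?_
  rintro τ ⟨⟨h0, h1⟩, heq⟩
  simp only [Multiset.mem_toFinset, Finset.mem_coe, Polynomial.mem_roots hQ, Polynomial.IsRoot.def]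
  rw [hLim_eq, gLim_eq, localLim, localLim, ← hκ] at heq
  have hA : lam * τ + (1 - τ) ≠ 0 := by nlinarith
  have hB : lam * (1 - τ) + (1 - (1 - τ)) ≠ 0 := by nlinarith
  -- Since 4τ(1 − τ) ≤ 1, the left side is at least 4λ² − (3λ + 1)(λ − 1) = (λ + 1)².
  have hD : 4 * lam ^ 2 - 4 * (τ * (1 - τ)) * ((3 * lam + 1) * (lam - 1)) ≠ 0 := by
    have : 0 < (3 * lam + 1) * (lam - 1) := by positivity
    nlinarith [sq_nonneg (2 * τ - 1)]
  rw [← mul_div_assoc, ← mul_div_assoc, div_add_div _ _ (by positivity) (by positivity),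
    div_eq_div_iff (by positivity) hD] at heq
  simp only [Q, NA, NB, A, B, D, G, Polynomial.eval_mul, Polynomial.eval_add, Polynomial.eval_sub,
    Polynomial.eval_pow, Polynomial.eval_C, Polynomial.eval_X, Polynomial.eval_one]
  linear_combination heq / 4

/-! ### Degree, triangle count and local clustering in a fixed graph -/

section Deterministic

theorem sum_offDiag_mul {ι : Type*} [DecidableEq ι] (s : Finset ι) (f : ι → ℝ) :
    ∑ p ∈ s.offDiag, f p.1 * f p.2 = (∑ j ∈ s, f j) ^ 2 - ∑ j ∈ s, f j * f j := by
  have h := Finset.sum_union (f := fun p : ι × ι => f p.1 * f p.2) s.disjoint_diag_offDiag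
  rw [Finset.diag_union_offDiag, Finset.sum_diag, Finset.sum_product, ← Finset.sum_mul_sum] at h
  rw [sq, h]
  ring

open Classical in
/-- The local clustering coefficient of the vertex `i`. -/
noncomputable def localClustering {n : ℕ} (G : SimpleGraph (Fin n)) (i : Fin n) : ℝ :=
  if 2 ≤ G.degree i then
    (∑ j : Fin n, ∑ k : Fin n,
      if j ≠ k then G.adjMatrix ℝ i j * G.adjMatrix ℝ j k * G.adjMatrix ℝ k i else 0) /
      ((G.degree i : ℝ) * ((G.degree i : ℝ) - 1))
  else 0

theorem avgClustering_eq {n : ℕ} (G : SimpleGraph (Fin n)) :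
    avgClustering G = (1 / (n : ℝ)) * ∑ i, localClustering G i := rfl

open Classical in
/-- The indicator of adjacency, as a real number. -/
noncomputable def adjInd {n : ℕ} (G : SimpleGraph (Fin n)) (i j : Fin n) : ℝ :=
  if G.Adj i j then 1 else 0

variable {n : ℕ} (G : SimpleGraph (Fin n)) (i j k : Fin n)

theorem adjInd_nonneg : 0 ≤ adjInd G i j := by
  unfold adjInd; split_ifs <;> norm_num

theorem adjInd_le_one : adjInd G i j ≤ 1 := by
  unfold adjInd; split_ifs <;> norm_num

theorem adjInd_comm : adjInd G i j = adjInd G j i := by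
  by_cases h : G.Adj i j
  · simp only [adjInd, if_pos h, if_pos h.symm]
  · simp only [adjInd, if_neg h, if_neg (fun h2 : G.Adj j i => h h2.symm)]

theorem adjInd_self : adjInd G i i = 0 := by
  simp [adjInd]

theorem adjInd_mul_self : adjInd G i j * adjInd G i j = adjInd G i j := by
  unfold adjInd; split_ifs <;> norm_num

/-- The degree of a vertex, as a real number. -/
noncomputable def realDegree : ℝ := ∑ j ∈ Finset.univ.erase i, adjInd G i j

/-- Twice the number of triangles through a vertex. -/
noncomputable def triangleCount : ℝ :=
  ∑ p ∈ (Finset.univ.erase i).offDiag, adjInd G i p.1 * adjInd G i p.2 * adjInd G p.1 p.2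

open Classical in
theorem degree_eq_realDegree : (G.degree i : ℝ) = realDegree G i := by
  have h := SimpleGraph.adjMatrix_mulVec_const_apply (G := G) (a := (1 : ℝ)) (v := i)
  rw [mul_one] at h
  rw [← h, realDegree, Finset.sum_erase _ (adjInd_self G i)]
  simp only [Matrix.mulVec, dotProduct, SimpleGraph.adjMatrix_apply, Function.const_apply, mul_one,
    adjInd]

open Classical in
theorem triangleCount_eq : (∑ j : Fin n, ∑ k : Fin n,
      if j ≠ k then G.adjMatrix ℝ i j * G.adjMatrix ℝ j k * G.adjMatrix ℝ k i else 0)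
      = triangleCount G i := by
  rw [← Finset.sum_product', triangleCount]
  symm
  have hsub : (Finset.univ.erase i).offDiag ⊆ (Finset.univ ×ˢ Finset.univ : Finset (Fin n × Fin n)) :=
    fun p _ => by simp
  refine (Finset.sum_congr rfl ?_).trans (Finset.sum_subset hsub ?_)
  · rintro ⟨j, k⟩ hp
    simp only [Finset.mem_offDiag] at hp
    rw [if_pos hp.2.2]
    simp only [SimpleGraph.adjMatrix_apply]
    change adjInd G i j * adjInd G i k * adjInd G j k = adjInd G i j * adjInd G j k * adjInd G k i
    rw [adjInd_comm G k i]
    ring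
  · rintro ⟨j, k⟩ - hp
    simp only [SimpleGraph.adjMatrix_apply]
    change (if j ≠ k then adjInd G i j * adjInd G j k * adjInd G k i else 0) = 0
    by_cases hjk : j = k
    · simp [hjk]
    · by_cases hj : j = i
      · simp [hj, adjInd_self]
      · by_cases hk : k = i
        · simp [hk, adjInd_self]
        · exact absurd (by simp [hj, hk, hjk]) hp

theorem triangleCount_nonneg : 0 ≤ triangleCount G i :=
  Finset.sum_nonneg fun _ _ => mul_nonneg (mul_nonneg (adjInd_nonneg ..) (adjInd_nonneg ..))
    (adjInd_nonneg ..)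

/-- Dropping the edge between the two neighbours leaves the number of ordered pairs of distinct
neighbours, which is d² − d because the adjacency indicators are idempotent. -/
theorem triangleCount_le :
    triangleCount G i ≤ realDegree G i * (realDegree G i - 1) := by
  have h1 := sum_offDiag_mul (Finset.univ.erase i) (adjInd G i)
  simp only [adjInd_mul_self] at h1
  have h2 : triangleCount G i
      ≤ ∑ p ∈ (Finset.univ.erase i).offDiag, adjInd G i p.1 * adjInd G i p.2 :=
    Finset.sum_le_sum fun p _ => mul_le_of_le_one_right
      (mul_nonneg (adjInd_nonneg ..) (adjInd_nonneg ..)) (adjInd_le_one ..)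
  refine h2.trans (h1.trans ?_).le
  unfold realDegree
  ring

/-- Division by zero accounts for the vertices of degree at most one. -/
theorem localClustering_eq_div :
    localClustering G i = triangleCount G i / (realDegree G i * (realDegree G i - 1)) := by
  classical
  have hc : localClustering G i = if 2 ≤ G.degree i then triangleCount G i /
      (realDegree G i * (realDegree G i - 1)) else 0 := by
    rw [← triangleCount_eq, ← degree_eq_realDegree]; rfl
  rw [hc, ite_eq_left_iff]
  intro h
  rw [← degree_eq_realDegree]
  have : G.degree i = 0 ∨ G.degree i = 1 := by omega
  rcases this with h | h <;> simp [h]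

/-- This survives degrees 0 and 1: there d(d − 1) = 0 bounds the triangle count, so both sides
vanish. -/
theorem localClustering_mul :
    localClustering G i * (realDegree G i * (realDegree G i - 1)) = triangleCount G i := by
  rw [localClustering_eq_div]
  by_cases h : realDegree G i * (realDegree G i - 1) = 0
  · have h2 := triangleCount_le G i
    rw [h] at h2
    rw [h, mul_zero]
    exact le_antisymm (triangleCount_nonneg G i) h2
  · exact div_mul_cancel₀ _ h

theorem localClustering_mem : 0 ≤ localClustering G i ∧ localClustering G i ≤ 1 := by
  rw [localClustering_eq_div]
  have h := (triangleCount_nonneg G i).trans (triangleCount_le G i)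
  exact ⟨div_nonneg (triangleCount_nonneg G i) h, div_le_one_of_le₀ (triangleCount_le G i) h⟩

/-- Write the local coefficient as C, with T = C d(d − 1). Then (C − t/m²) m² = (T − t) − C (d(d −
1) − m²), and 0 ≤ C ≤ 1. The random denominator is thus replaced by a deterministic one, and no
lower bound on the degree is needed. -/
theorem abs_localClustering_sub_le {m t : ℝ} (hm : 0 < m) :
    |localClustering G i - t / m ^ 2|
      ≤ (|realDegree G i * (realDegree G i - 1) - m ^ 2| + |triangleCount G i - t|) / m ^ 2 := by
  have hf := localClustering_mem G i
  have hT := localClustering_mul G i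
  rw [le_div_iff₀ (by positivity), ← abs_of_pos (show 0 < m ^ 2 by positivity), ← abs_mul,
    abs_of_pos (show 0 < m ^ 2 by positivity)]
  have : (localClustering G i - t / m ^ 2) * m ^ 2
      = -(localClustering G i * (realDegree G i * (realDegree G i - 1) - m ^ 2))
        + (triangleCount G i - t) := by
    rw [← hT]; field_simp; ring
  rw [this]
  refine (abs_add_le _ _).trans ?_
  refine add_le_add ?_ le_rfl
  rw [abs_neg, abs_mul, abs_of_nonneg hf.1]
  exact mul_le_of_le_one_left (abs_nonneg _) hf.2

end Deterministic

/-! ### Second moment bounds for sums over vertices and over pairs -/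

/-- A union bound over the four ways in which two index pairs can share an entry; each way keeps the
factor at the entry that is not shared. -/
theorem ite_or_le {c₁ c₂ c₃ c₄ : Prop} [Decidable c₁] [Decidable c₂] [Decidable c₃] [Decidable c₄]
    [Decidable (c₁ ∨ c₂ ∨ c₃ ∨ c₄)] {z x y : ℝ} (hx : z ≤ x) (hy : z ≤ y) (hx0 : 0 ≤ x)
    (hy0 : 0 ≤ y) : (if c₁ ∨ c₂ ∨ c₃ ∨ c₄ then z else 0) ≤
      (((if c₁ then 1 else 0) * y + (if c₂ then 1 else 0) * y)
        + (x * (if c₃ then 1 else 0) + x * (if c₄ then 1 else 0))) := by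
  by_cases h₁ : c₁ <;> by_cases h₂ : c₂ <;> by_cases h₃ : c₃ <;> by_cases h₄ : c₄ <;>
    simp [h₁, h₂, h₃, h₄] <;> linarith

section SecondMoment

variable {Ω E ι : Type*} [MeasurableSpace Ω] [MeasurableSpace E] {P : Measure Ω}
  [IsProbabilityMeasure P]

theorem memLp_two_of_bounded {X : Ω → ℝ} (hX : Measurable X) {C : ℝ}
    (h : ∀ ω, |X ω| ≤ C) : MemLp X 2 P :=
  MemLp.of_bound hX.aestronglyMeasurable C (ae_of_all _ h)

theorem integrable_of_bounded {X : Ω → ℝ} (hX : Measurable X) {C : ℝ}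
    (h : ∀ ω, |X ω| ≤ C) : Integrable X P :=
  Integrable.of_bound hX.aestronglyMeasurable C (ae_of_all _ h)

theorem integral_abs_sub_mean_le {X : Ω → ℝ} (hX : MemLp X 2 P) {v : ℝ} (hv : Var[X; P] ≤ v) :
    ∫ ω, |X ω - ∫ ω', X ω' ∂P| ∂P ≤ √v := by
  have hY : MemLp (fun ω => |X ω - ∫ ω', X ω' ∂P|) 2 P := (hX.sub (memLp_const _)).abs
  -- The variance of |X − E X| being nonnegative is exactly (E|X − E X|)² ≤ Var X.
  have h1 := variance_nonneg (fun ω => |X ω - ∫ ω', X ω' ∂P|) P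
  rw [variance_eq_sub hY] at h1
  have h2 : ∫ ω, ((fun ω => |X ω - ∫ ω', X ω' ∂P|) ^ 2) ω ∂P = Var[X; P] := by
    rw [variance_eq_integral hX.aemeasurable]
    simp only [Pi.pow_apply, sq_abs]
  rw [h2] at h1
  exact Real.le_sqrt_of_sq_le (by linarith)

variable {Z : ι → Ω → E} {α : ι → E → ℝ}

theorem variance_sum_le_of_unit (hZ : iIndepFun Z P) (hZm : ∀ i, Measurable (Z i))
    (hαm : ∀ j, Measurable (α j)) (h0 : ∀ j x, 0 ≤ α j x) (h1 : ∀ j x, α j x ≤ 1)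
    (s : Finset ι) :
    Var[fun ω => ∑ j ∈ s, α j (Z j ω); P] ≤ ∫ ω, ∑ j ∈ s, α j (Z j ω) ∂P := by
  have hm : ∀ j, Measurable fun ω => α j (Z j ω) := fun j => (hαm j).comp (hZm j)
  have hb : ∀ j ω, |α j (Z j ω)| ≤ 1 := fun j ω => by rw [abs_of_nonneg (h0 _ _)]; exact h1 _ _
  have hL : ∀ j, MemLp (fun ω => α j (Z j ω)) 2 P := fun j => memLp_two_of_bounded (hm j) (hb j)
  have hsum : (fun ω => ∑ j ∈ s, α j (Z j ω)) = ∑ j ∈ s, fun ω => α j (Z j ω) := by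
    ext ω; simp
  rw [hsum, IndepFun.variance_sum (fun j _ => hL j)
    (fun j _ k _ hjk => (hZ.indepFun hjk).comp (hαm j) (hαm k)), ← hsum,
    integral_finsetSum _ (fun j _ => integrable_of_bounded (hm j) (hb j))]
  refine Finset.sum_le_sum fun j _ => ?_
  refine (variance_le_expectation_sq (hm j).aestronglyMeasurable).trans ?_
  refine integral_mono (hL j).integrable_sq (integrable_of_bounded (hm j) (hb j)) fun ω => ?_
  have := h0 j (Z j ω)
  have := h1 j (Z j ω)
  simp only [Pi.pow_apply]
  nlinarith

/-- Expand the variance into covariances of pairs p, q. Disjoint pairs are independent, so only q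
meeting p counts. In such a product the shared factor of `F q` is bounded by 1, leaving a product of
at most three of the `a`, two of them at distinct indices. Summing over q costs 4 · r²(2 + |s| r),
and there are at most |s|² choices of p. -/
theorem variance_sum_offDiag_le [DecidableEq ι] (hZ : iIndepFun Z P) (hZm : ∀ i, Measurable (Z i))
    (hαm : ∀ j, Measurable (α j)) (h0 : ∀ j x, 0 ≤ α j x) (h1 : ∀ j x, α j x ≤ 1)
    {β : ι × ι → E × E → ℝ} (hβm : ∀ p, Measurable (β p)) (hβ0 : ∀ p x, 0 ≤ β p x)
    (hβ : ∀ p x, β p x ≤ α p.1 x.1 * α p.2 x.2) {r : ℝ} (hr : 0 ≤ r)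
    (hαr : ∀ j, ∫ ω, α j (Z j ω) ∂P ≤ r) (s : Finset ι) :
    Var[fun ω => ∑ p ∈ s.offDiag, β p (Z p.1 ω, Z p.2 ω); P]
      ≤ (s.card : ℝ) ^ 2 * (4 * (r ^ 2 * (2 + s.card * r))) := by
  set a : ι → Ω → ℝ := fun j ω => α j (Z j ω)
  set F : ι × ι → Ω → ℝ := fun p ω => β p (Z p.1 ω, Z p.2 ω)
  have ham : ∀ j, Measurable (a j) := fun j => (hαm j).comp (hZm j)
  have ha0 : ∀ j ω, 0 ≤ a j ω := fun j ω => h0 _ _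
  have ha1 : ∀ j ω, a j ω ≤ 1 := fun j ω => h1 _ _
  have hFm : ∀ p, Measurable (F p) := fun p => (hβm p).comp ((hZm _).prodMk (hZm _))
  have hF0 : ∀ p ω, 0 ≤ F p ω := fun p ω => hβ0 _ _
  have hFa : ∀ p ω, F p ω ≤ a p.1 ω * a p.2 ω := fun p ω => hβ _ _
  have hF1 : ∀ p ω, F p ω ≤ 1 := fun p ω => (hFa p ω).trans (mul_le_one₀ (ha1 _ _) (ha0 _ _) (ha1 _ _))
  have hFb : ∀ p ω, |F p ω| ≤ 1 := fun p ω => by rw [abs_of_nonneg (hF0 _ _)]; exact hF1 _ _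
  have hFL : ∀ p, MemLp (F p) 2 P := fun p => memLp_two_of_bounded (hFm p) (hFb p)
  have hIFF : ∀ p q, Integrable (fun ω => F p ω * F q ω) P := fun p q =>
    integrable_of_bounded ((hFm p).mul (hFm q)) (C := 1) fun ω => by
      rw [abs_of_nonneg (mul_nonneg (hF0 _ _) (hF0 _ _))]
      exact mul_le_one₀ (hF1 _ _) (hF0 _ _) (hF1 _ _)
  have hI2 : ∀ j k, Integrable (fun ω => a j ω * a k ω) P := fun j k =>
    integrable_of_bounded ((ham j).mul (ham k)) (C := 1) fun ω => by
      rw [abs_of_nonneg (mul_nonneg (ha0 _ _) (ha0 _ _))]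
      exact mul_le_one₀ (ha1 _ _) (ha0 _ _) (ha1 _ _)
  have hI3 : ∀ j k m, Integrable (fun ω => a j ω * a k ω * a m ω) P := fun j k m =>
    integrable_of_bounded (((ham j).mul (ham k)).mul (ham m)) (C := 1) fun ω => by
      rw [abs_of_nonneg (mul_nonneg (mul_nonneg (ha0 _ _) (ha0 _ _)) (ha0 _ _))]
      exact mul_le_one₀ (mul_le_one₀ (ha1 _ _) (ha0 _ _) (ha1 _ _)) (ha0 _ _) (ha1 _ _)
  have hEa0 : ∀ j, 0 ≤ ∫ ω, a j ω ∂P := fun j => integral_nonneg (ha0 j)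
  have hE2 : ∀ j k, j ≠ k → ∫ ω, a j ω * a k ω ∂P ≤ r ^ 2 := by
    intro j k hjk
    have heq : ∫ ω, a j ω * a k ω ∂P = (∫ ω, a j ω ∂P) * ∫ ω, a k ω ∂P :=
      ((hZ.indepFun hjk).comp (hαm j) (hαm k)).integral_fun_mul_eq_mul_integral
        (ham j).aestronglyMeasurable (ham k).aestronglyMeasurable
    rw [heq, sq]
    exact mul_le_mul (hαr j) (hαr k) (hEa0 k) hr
  -- A third index that repeats `j` or `k` contributes at most the factor 1; a new one is
  -- independent and contributes at most `r`.
  have hE3 : ∀ j k m, j ≠ k → ∫ ω, a j ω * a k ω * a m ω ∂P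
      ≤ r ^ 2 * ((if m = j then 1 else 0) + (if m = k then 1 else 0) + r) := by
    intro j k m hjk
    by_cases hm : m = j ∨ m = k
    · have hle : ∫ ω, a j ω * a k ω * a m ω ∂P ≤ r ^ 2 :=
        (integral_mono (hI3 j k m) (hI2 j k) fun ω =>
          mul_le_of_le_one_right (mul_nonneg (ha0 _ _) (ha0 _ _)) (ha1 _ _)).trans (hE2 j k hjk)
      have : (1 : ℝ) ≤ (if m = j then 1 else 0) + (if m = k then 1 else 0) + r := by
        rcases hm with hm | hm
        · rw [if_pos hm]; split_ifs <;> linarith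
        · rw [if_pos hm]; split_ifs <;> linarith
      exact hle.trans (le_mul_of_one_le_right (sq_nonneg r) this)
    · push Not at hm
      rw [if_neg hm.1, if_neg hm.2]
      have hi := ((hZ.indepFun_prodMk hZm j k m hm.1.symm hm.2.symm).comp
        (((hαm j).comp measurable_fst).mul ((hαm k).comp measurable_snd)) (hαm m))
      have := hi.integral_fun_mul_eq_mul_integral ((ham j).mul (ham k)).aestronglyMeasurable
        (ham m).aestronglyMeasurable
      have heq : ∫ ω, a j ω * a k ω * a m ω ∂P = (∫ ω, a j ω * a k ω ∂P) * ∫ ω, a m ω ∂P := this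
      rw [heq, zero_add, zero_add]
      exact mul_le_mul (hE2 j k hjk) (hαr m) (hEa0 m) (sq_nonneg r)
  have hES : ∀ j k, j ≠ k → ∫ ω, a j ω * a k ω * ∑ m ∈ s, a m ω ∂P
      ≤ r ^ 2 * (2 + s.card * r) := by
    intro j k hjk
    simp only [Finset.mul_sum]
    rw [integral_finsetSum _ (fun m _ => hI3 j k m)]
    refine (Finset.sum_le_sum fun m _ => hE3 j k m hjk).trans ?_
    rw [← Finset.mul_sum, Finset.sum_add_distrib, Finset.sum_add_distrib, Finset.sum_ite_eq',
      Finset.sum_ite_eq', Finset.sum_const, nsmul_eq_mul]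
    gcongr
    split_ifs <;> norm_num
  let meets : ι × ι → ι × ι → Prop := fun p q =>
    q.1 = p.1 ∨ q.1 = p.2 ∨ q.2 = p.1 ∨ q.2 = p.2
  have : ∀ p q, Decidable (meets p q) := fun p q => by unfold meets; infer_instance
  -- For meeting pairs the product of the means is nonnegative and is discarded.
  have hcov : ∀ p q, cov[F p, F q; P] ≤ if meets p q then ∫ ω, F p ω * F q ω ∂P else 0 := by
    intro p q
    split_ifs with h
    · rw [covariance_eq_sub (hFL p) (hFL q)]
      have : 0 ≤ (∫ x, F p x ∂P) * ∫ x, F q x ∂P :=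
        mul_nonneg (integral_nonneg (hF0 p)) (integral_nonneg (hF0 q))
      simp only [Pi.mul_apply]
      linarith
    · simp only [meets] at h
      push Not at h
      have hi := (hZ.indepFun_prodMk_prodMk hZm p.1 p.2 q.1 q.2 h.1.symm h.2.2.1.symm
        h.2.1.symm h.2.2.2.symm).comp (hβm p) (hβm q)
      exact (IndepFun.covariance_eq_zero hi (hFL p) (hFL q)).le
  have hpt : ∀ p ω, ∑ q ∈ s.offDiag, (if meets p q then F q ω else 0) ≤ 4 * ∑ m ∈ s, a m ω := by
    intro p ω
    have hq : ∀ q ∈ s ×ˢ s, (if meets p q then F q ω else 0) ≤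
        (((if q.1 = p.1 then 1 else 0) * a q.2 ω + (if q.1 = p.2 then 1 else 0) * a q.2 ω)
        + (a q.1 ω * (if q.2 = p.1 then 1 else 0) + a q.1 ω * (if q.2 = p.2 then 1 else 0))) := by
      intro q _
      have e1 : F q ω ≤ a q.1 ω :=
        (hFa q ω).trans (mul_le_of_le_one_right (ha0 _ _) (ha1 _ _))
      have e2 : F q ω ≤ a q.2 ω :=
        (hFa q ω).trans (mul_le_of_le_one_left (ha0 _ _) (ha1 _ _))
      have e3 := ha0 q.1 ω
      have e4 := ha0 q.2 ω
      exact ite_or_le e1 e2 e3 e4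
    have hsub : s.offDiag ⊆ s ×ˢ s := fun q hq => by
      simp only [Finset.mem_offDiag] at hq
      exact Finset.mem_product.2 ⟨hq.1, hq.2.1⟩
    refine (Finset.sum_le_sum_of_subset_of_nonneg hsub fun q _ _ => ?_).trans
      ((Finset.sum_le_sum hq).trans ?_)
    · split_ifs
      exacts [hF0 _ _, le_rfl]
    have hS : 0 ≤ ∑ m ∈ s, a m ω := Finset.sum_nonneg fun m _ => ha0 m ω
    have hite : ∀ x, (∑ m ∈ s, if m = x then (1 : ℝ) else 0) ≤ 1 := fun x => by
      rw [Finset.sum_ite_eq']; split_ifs <;> norm_num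
    simp only [Finset.sum_add_distrib]
    rw [Finset.sum_product, Finset.sum_product, Finset.sum_product, Finset.sum_product]
    have m1 := mul_le_of_le_one_left hS (hite p.1)
    have m2 := mul_le_of_le_one_left hS (hite p.2)
    have m3 := mul_le_of_le_one_right hS (hite p.1)
    have m4 := mul_le_of_le_one_right hS (hite p.2)
    rw [Finset.sum_mul_sum] at m1 m2 m3 m4
    linarith
  have hrow : ∀ p ∈ s.offDiag, ∑ q ∈ s.offDiag, cov[F p, F q; P]
      ≤ 4 * (r ^ 2 * (2 + s.card * r)) := by
    intro p hp
    have hne : p.1 ≠ p.2 := (Finset.mem_offDiag.1 hp).2.2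
    have hIS : Integrable (fun ω => a p.1 ω * a p.2 ω * ∑ m ∈ s, a m ω) P := by
      simp only [Finset.mul_sum]
      exact integrable_finsetSum _ fun m _ => hI3 _ _ m
    calc ∑ q ∈ s.offDiag, cov[F p, F q; P]
        ≤ ∑ q ∈ s.offDiag, if meets p q then ∫ ω, F p ω * F q ω ∂P else 0 :=
          Finset.sum_le_sum fun q _ => hcov p q
      _ = ∑ q ∈ s.offDiag, ∫ ω, (if meets p q then F p ω * F q ω else 0) ∂P := by
          refine Finset.sum_congr rfl fun q _ => ?_
          split_ifs <;> simp
      _ = ∫ ω, ∑ q ∈ s.offDiag, (if meets p q then F p ω * F q ω else 0) ∂P := by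
          rw [integral_finsetSum]
          intro q _
          split_ifs
          exacts [hIFF p q, integrable_zero _ _ _]
      _ ≤ ∫ ω, 4 * (a p.1 ω * a p.2 ω * ∑ m ∈ s, a m ω) ∂P := by
          refine integral_mono ?_ (hIS.const_mul 4) fun ω => ?_
          · refine integrable_finsetSum _ fun q _ => ?_
            split_ifs
            exacts [hIFF p q, integrable_zero _ _ _]
          · have e : ∑ q ∈ s.offDiag, (if meets p q then F p ω * F q ω else 0)
                = F p ω * ∑ q ∈ s.offDiag, (if meets p q then F q ω else 0) := by
              simp only [Finset.mul_sum, mul_ite, mul_zero]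
            simp only [e]
            have hS : 0 ≤ ∑ m ∈ s, a m ω := Finset.sum_nonneg fun m _ => ha0 m ω
            calc _ ≤ F p ω * (4 * ∑ m ∈ s, a m ω) :=
                  mul_le_mul_of_nonneg_left (hpt p ω) (hF0 _ _)
              _ ≤ a p.1 ω * a p.2 ω * (4 * ∑ m ∈ s, a m ω) :=
                  mul_le_mul_of_nonneg_right (hFa p ω) (by positivity)
              _ = _ := by ring
      _ ≤ 4 * (r ^ 2 * (2 + s.card * r)) := by
          rw [integral_const_mul]
          exact mul_le_mul_of_nonneg_left (hES _ _ hne) (by norm_num)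
  have hsum : (fun ω => ∑ p ∈ s.offDiag, F p ω) = ∑ p ∈ s.offDiag, F p := by
    ext ω; simp
  rw [hsum, variance_sum' fun p _ => hFL p]
  refine (Finset.sum_le_sum hrow).trans ?_
  rw [Finset.sum_const, nsmul_eq_mul]
  have hcard : (s.offDiag.card : ℝ) ≤ (s.card : ℝ) ^ 2 := by
    rw [Finset.offDiag_card, sq]
    exact_mod_cast Nat.sub_le _ _
  exact mul_le_mul_of_nonneg_right hcard (by positivity)

end SecondMoment

/-! ### Triangle probabilities and relative positions on the circle -/

section Circle

instance : IsProbabilityMeasure (volume : Measure UnitAddCircle) :=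
  ⟨by rw [AddCircle.measure_univ, ENNReal.ofReal_one]⟩

theorem norm_coe_eq_min {w : ℝ} (hw : |w| ≤ 1) : ‖(w : UnitAddCircle)‖ = min |w| (1 - |w|) := by
  have key : ∀ {v : ℝ}, |v| ≤ 1 / 2 → ‖(v : UnitAddCircle)‖ = |v| := fun {v} hv =>
    (AddCircle.norm_coe_eq_abs_iff 1 one_ne_zero).2 (by rwa [abs_one])
  rcases le_or_gt |w| (1 / 2) with h | h
  · rw [key h, min_eq_left (by linarith)]
  · rw [min_eq_right (by linarith)]
    rcases le_or_gt 0 w with h0 | h0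
    · rw [abs_of_nonneg h0] at *
      have e : ((w - 1 : ℝ) : UnitAddCircle) = w := by rw [AddCircle.coe_sub, AddCircle.coe_period, sub_zero]
      rw [← e, key (abs_le.2 ⟨by linarith, by linarith⟩), abs_of_nonpos (by linarith)]
      ring
    · rw [abs_of_neg h0] at *
      have e : ((w + 1 : ℝ) : UnitAddCircle) = w := AddCircle.coe_add_period 1 w
      rw [← e, key (abs_le.2 ⟨by linarith, by linarith⟩), abs_of_nonneg (by linarith)]
      ring

theorem circDist_eq_norm {x y : ℝ} (hx : x ∈ Set.Icc (0 : ℝ) 1) (hy : y ∈ Set.Icc (0 : ℝ) 1) :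
    circDist x y = ‖(x : UnitAddCircle) - (y : UnitAddCircle)‖ := by
  have h : |x - y| ≤ 1 := abs_le.2 ⟨by linarith [hx.1, hy.2], by linarith [hx.2, hy.1]⟩
  rw [← AddCircle.coe_sub, norm_coe_eq_min h, circDist]

theorem measure_norm_le {r : ℝ} (h0 : 0 ≤ r) (h : r ≤ 1 / 2) :
    (volume : Measure UnitAddCircle).real {z | ‖z‖ ≤ r} = 2 * r := by
  have e : {z : UnitAddCircle | ‖z‖ ≤ r} = Metric.closedBall 0 r := by ext; simp
  rw [e, Measure.real, AddCircle.volume_closedBall, min_eq_right (by linarith),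
    ENNReal.toReal_ofReal (by linarith)]

/-- For |z| ≤ b the bounds force |y − z| < 2/3, so the way around the circle is longer than 1/3 ≥ b.
The set is then an intersection of two real intervals, empty when 2b < |y|. -/
theorem volume_lens {b y : ℝ} (hb : b ≤ 1 / 3) (hy : |y| < 1 / 3) :
    volume {z : UnitAddCircle | ‖z‖ ≤ b ∧ ‖(y : UnitAddCircle) - z‖ ≤ b}
      = ENNReal.ofReal (2 * b - |y|) := by
  have hm : MeasurableSet {z : UnitAddCircle | ‖z‖ ≤ b ∧ ‖(y : UnitAddCircle) - z‖ ≤ b} := by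
    have h1 : MeasurableSet {z : UnitAddCircle | ‖z‖ ≤ b} :=
      measurableSet_le (by fun_prop) (by fun_prop)
    have h2 : MeasurableSet {z : UnitAddCircle | ‖(y : UnitAddCircle) - z‖ ≤ b} :=
      measurableSet_le (by fun_prop) (by fun_prop)
    exact h1.inter h2
  have hmp := UnitAddCircle.measurePreserving_mk (-(1 / 2))
  rw [← hmp.measure_preimage hm.nullMeasurableSet, Measure.restrict_apply (hmp.measurable hm)]
  have hset : (QuotientAddGroup.mk ⁻¹' {z : UnitAddCircle | ‖z‖ ≤ b ∧ ‖(y : UnitAddCircle) - z‖ ≤ b})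
      ∩ Set.Ioc (-(1 / 2)) (-(1 / 2) + 1) = Set.Icc (max (-b) (y - b)) (min b (y + b)) := by
    ext z
    have hy' := abs_lt.1 hy
    have hz : |z| ≤ 1 / 2 → ((‖(z : UnitAddCircle)‖ ≤ b ∧ ‖(y : UnitAddCircle) - z‖ ≤ b) ↔
        (|z| ≤ b ∧ |y - z| ≤ b)) := by
      intro hz
      have h1 : ‖(z : UnitAddCircle)‖ = |z| := by
        rw [norm_coe_eq_min (by linarith), min_eq_left (by linarith)]
      rw [h1]
      refine and_congr_right fun hzb => ?_
      have h2 : |y - z| < 2 / 3 := by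
        refine (abs_sub _ _).trans_lt ?_
        linarith
      rw [← AddCircle.coe_sub, norm_coe_eq_min (by linarith), min_le_iff]
      constructor
      · rintro (h | h)
        · exact h
        · linarith
      · exact Or.inl
    simp only [Set.mem_inter_iff, Set.mem_preimage, Set.mem_ofPred_eq, Set.mem_Ioc, Set.mem_Icc,
      max_le_iff, le_min_iff]
    constructor
    · rintro ⟨h, h3, h4⟩
      have := (hz (abs_le.2 ⟨by linarith, by linarith⟩)).1 h
      rw [abs_le, abs_le] at this
      refine ⟨⟨?_, ?_⟩, ?_, ?_⟩ <;> linarith [this.1.1, this.1.2, this.2.1, this.2.2]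
    · rintro ⟨⟨h1, h2⟩, h3, h4⟩
      refine ⟨(hz (abs_le.2 ⟨by linarith, by linarith⟩)).2 ⟨abs_le.2 ⟨h1, h3⟩, abs_le.2 ⟨?_, ?_⟩⟩,
        ?_, ?_⟩ <;> linarith
  rw [hset, Real.volume_Icc]
  congr 1
  rcases le_total 0 y with h | h
  · rw [abs_of_nonneg h, min_eq_left (by linarith), max_eq_right (by linarith)]; ring
  · rw [abs_of_nonpos h, min_eq_right (by linarith), max_eq_left (by linarith)]; ring

theorem setLIntegral_tent {a b : ℝ} (ha : 0 ≤ a) (hb : 0 ≤ b) :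
    ∫⁻ y in Set.Ioo (-a) a, ENNReal.ofReal (2 * b - |y|)
      = ENNReal.ofReal (4 * b * min a (2 * b) - min a (2 * b) ^ 2) := by
  set m := min a (2 * b) with hm
  have hm0 : 0 ≤ m := le_min ha (by linarith)
  have hma : m ≤ a := min_le_left _ _
  have hmb : m ≤ 2 * b := min_le_right _ _
  -- `ENNReal.ofReal` truncates at zero, so nothing is contributed where |y| ≥ 2b.
  have h1 : ∫⁻ y in Set.Ioo (-a) a, ENNReal.ofReal (2 * b - |y|)
      = ∫⁻ y in Set.Ioo (-m) m, ENNReal.ofReal (2 * b - |y|) := by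
    rw [← lintegral_indicator measurableSet_Ioo, ← lintegral_indicator measurableSet_Ioo]
    congr 1
    ext y
    by_cases hy : y ∈ Set.Ioo (-m) m
    · have hya : y ∈ Set.Ioo (-a) a := ⟨by linarith [hy.1], by linarith [hy.2]⟩
      rw [Set.indicator_of_mem hy, Set.indicator_of_mem hya]
    · rw [Set.indicator_of_notMem hy]
      by_cases hy2 : y ∈ Set.Ioo (-a) a
      · rw [Set.indicator_of_mem hy2, ENNReal.ofReal_eq_zero]
        have e1 : |y| < a := abs_lt.2 hy2
        have e2 : m ≤ |y| := by
          by_contra h; exact hy (abs_lt.1 (not_le.1 h))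
        rcases min_choice a (2 * b) with h | h <;> rw [← hm] at h <;> linarith
      · rw [Set.indicator_of_notMem hy2]
  rw [h1, ← ofReal_integral_eq_lintegral_ofReal, ← integral_Ioc_eq_integral_Ioo,
    ← intervalIntegral.integral_of_le (by linarith)]
  · congr 1
    rw [← intervalIntegral.integral_add_adjacent_intervals (b := 0)
      (Continuous.intervalIntegrable (by fun_prop) _ _)
      (Continuous.intervalIntegrable (by fun_prop) _ _)]
    have e1 : ∫ y in (-m)..0, (2 * b - |y|) = ∫ y in (-m)..0, (2 * b + y) :=
      intervalIntegral.integral_congr fun y hy => by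
        rw [Set.uIcc_of_le (by linarith)] at hy
        simp only [abs_of_nonpos hy.2]; ring
    have e2 : ∫ y in (0)..m, (2 * b - |y|) = ∫ y in (0)..m, (2 * b - y) :=
      intervalIntegral.integral_congr fun y hy => by
        rw [Set.uIcc_of_le hm0] at hy
        simp only [abs_of_nonneg hy.1]
    rw [e1, e2, intervalIntegral.integral_add (by simp) (by simp),
      intervalIntegral.integral_sub (by simp) (by simp)]
    simp only [intervalIntegral.integral_const, integral_id, smul_eq_mul]
    ring
  · exact (Continuous.integrableOn_Icc (by fun_prop)).mono_set Set.Ioo_subset_Icc_self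
  · filter_upwards [ae_restrict_mem measurableSet_Ioo] with y hy
    have : |y| < m := abs_lt.2 hy
    simp only [Pi.zero_apply]
    linarith

/-- The probability that two independent uniform points of the circle lie within distances
`a` and `b` of the origin and within distance `c` of each other. -/
noncomputable def triangleProb (a b c : ℝ) : ℝ :=
  (volume : Measure (UnitAddCircle × UnitAddCircle)).real
    {p | ‖p.1‖ ≤ a ∧ ‖p.2‖ ≤ b ∧ ‖p.1 - p.2‖ ≤ c}

theorem measurableSet_triangle (a b c : ℝ) : MeasurableSet
    {p : UnitAddCircle × UnitAddCircle | ‖p.1‖ ≤ a ∧ ‖p.2‖ ≤ b ∧ ‖p.1 - p.2‖ ≤ c} := by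
  have h1 : MeasurableSet {p : UnitAddCircle × UnitAddCircle | ‖p.1‖ ≤ a} :=
    measurableSet_le (by fun_prop) (by fun_prop)
  have h2 : MeasurableSet {p : UnitAddCircle × UnitAddCircle | ‖p.2‖ ≤ b} :=
    measurableSet_le (by fun_prop) (by fun_prop)
  have h3 : MeasurableSet {p : UnitAddCircle × UnitAddCircle | ‖p.1 - p.2‖ ≤ c} :=
    measurableSet_le (by fun_prop) (by fun_prop)
  exact h1.inter (h2.inter h3)

theorem triangleProb_swap (a b c : ℝ) : triangleProb a b c = triangleProb b a c := by
  have h := (Measure.measurePreserving_swap (μ := (volume : Measure UnitAddCircle))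
    (ν := (volume : Measure UnitAddCircle))).measureReal_preimage
      (measurableSet_triangle b a c).nullMeasurableSet
  rw [triangleProb, triangleProb, Measure.volume_eq_prod, ← h]
  congr 1
  ext p
  simp only [Set.mem_preimage, Set.mem_ofPred_eq, Prod.fst_swap, Prod.snd_swap, norm_sub_rev p.2 p.1]
  tauto

/-- The triangle is rebased at another vertex: (u, v) ↦ (v − u, v) is a continuous involutive
endomorphism of the torus, hence preserves Haar measure, and it exchanges the first and third sides.
-/
theorem triangleProb_rotate (a b c : ℝ) : triangleProb a b c = triangleProb c b a := by
  let f : UnitAddCircle × UnitAddCircle →+ UnitAddCircle × UnitAddCircle :=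
    (AddMonoidHom.snd UnitAddCircle UnitAddCircle -
      AddMonoidHom.fst UnitAddCircle UnitAddCircle).prod (AddMonoidHom.snd _ _)
  have hf : ∀ p, f p = (p.2 - p.1, p.2) := fun p => rfl
  have hmp : MeasurePreserving f (volume : Measure (UnitAddCircle × UnitAddCircle))
      (volume : Measure (UnitAddCircle × UnitAddCircle)) := by
    have : (volume : Measure (UnitAddCircle × UnitAddCircle)).IsAddHaarMeasure :=
      Measure.prod.instIsAddHaarMeasure _ _
    refine AddMonoidHom.measurePreserving ?_ ?_ rfl
    · change Continuous fun p : UnitAddCircle × UnitAddCircle => (p.2 - p.1, p.2)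
      fun_prop
    · intro p
      exact ⟨(p.2 - p.1, p.2), by rw [hf]; simp⟩
  rw [triangleProb, triangleProb,
    ← hmp.measureReal_preimage (measurableSet_triangle c b a).nullMeasurableSet]
  congr 1
  ext p
  simp only [Set.mem_preimage, Set.mem_ofPred_eq, hf, norm_sub_rev p.2 p.1, sub_sub_cancel_left,
    norm_neg]
  tauto

/-- By Fubini: once the first point is at y, the second ranges over the lens of length (2b − |y|)⁺,
and the tent is integrated over |y| < a. -/
theorem triangleProb_isosceles {a b : ℝ} (ha0 : 0 ≤ a) (ha : a ≤ 1 / 3) (hb0 : 0 ≤ b)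
    (hb : b ≤ 1 / 3) :
    triangleProb a b b = 4 * b * min a (2 * b) - min a (2 * b) ^ 2 := by
  have hpos : 0 ≤ 4 * b * min a (2 * b) - min a (2 * b) ^ 2 := by
    have h1 : 0 ≤ min a (2 * b) := le_min ha0 (by linarith)
    have h2 : min a (2 * b) ≤ 2 * b := min_le_right _ _
    nlinarith
  rw [triangleProb, Measure.real, Measure.volume_eq_prod,
    Measure.prod_apply (measurableSet_triangle a b b), ← UnitAddCircle.lintegral_preimage (-(1 / 2)),
    ← ENNReal.toReal_ofReal hpos, ← setLIntegral_tent ha0 hb0,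
    ← lintegral_indicator measurableSet_Ioc, ← lintegral_indicator measurableSet_Ioo]
  congr 1
  refine lintegral_congr_ae ?_
  -- The endpoints ±a form a null set; removing them supplies the strict inequality |y| < 1/3 of
  -- `volume_lens` even when a = 1/3.
  filter_upwards [Measure.ae_ne volume a, Measure.ae_ne volume (-a)] with y hy1 hy2
  by_cases hy : y ∈ Set.Ioo (-a) a
  · have hya : |y| < a := abs_lt.2 hy
    have hyc : y ∈ Set.Ioc (-(1 / 2) : ℝ) (-(1 / 2) + 1) :=
      ⟨by linarith [hy.1], by linarith [hy.2]⟩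
    rw [Set.indicator_of_mem hyc, Set.indicator_of_mem hy,
      ← volume_lens hb (hya.trans_le ha)]
    congr 1
    ext z
    have : ‖(y : UnitAddCircle)‖ ≤ a := by
      rw [norm_coe_eq_min (by linarith)]
      exact (min_le_left _ _).trans hya.le
    simp [this]
  · rw [Set.indicator_of_notMem hy]
    by_cases hy3 : y ∈ Set.Ioc (-(1 / 2) : ℝ) (-(1 / 2) + 1)
    · rw [Set.indicator_of_mem hy3]
      have h1 : |y| ≤ 1 / 2 := abs_le.2 ⟨hy3.1.le, by linarith [hy3.2]⟩
      have h2 : a < |y| := by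
        by_contra h
        obtain ⟨h3, h4⟩ := abs_le.1 (not_lt.1 h)
        exact hy ⟨lt_of_le_of_ne h3 hy2.symm, lt_of_le_of_ne h4 hy1⟩
      have h3 : ¬ ‖(y : UnitAddCircle)‖ ≤ a := by
        rw [norm_coe_eq_min (by linarith), min_eq_left (by linarith)]
        linarith
      simp [h3]
    · rw [Set.indicator_of_notMem hy3]

theorem triangleProb_scaled {lam b : ℝ} (hl : 1 ≤ lam) (hb : 0 ≤ b) (hlb : lam * b ≤ 1 / 3) :
    triangleProb (lam * b) b b = mixedCoeff lam * b ^ 2 := by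
  rw [triangleProb_isosceles (by positivity) hlb hb (by nlinarith), mixedCoeff]
  split_ifs with h
  · rw [min_eq_left (by nlinarith)]; ring
  · rw [min_eq_right (by nlinarith)]; ring

theorem triangleProb_equilateral {a : ℝ} (ha0 : 0 ≤ a) (ha : a ≤ 1 / 3) :
    triangleProb a a a = 3 * a ^ 2 := by
  rw [triangleProb_isosceles ha0 ha ha0 ha, min_eq_left (by linarith)]; ring

/-- The positions relative to that of the vertex `i`. -/
def relPos {n : ℕ} (i : Fin n) (x : Fin n → UnitAddCircle) (j : Fin n) : UnitAddCircle :=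
  if j = i then x i else x j - x i

/-- Keeping `x i` in its own slot makes the shift a surjective continuous endomorphism of the torus,
so it preserves Haar measure. This is why the relative positions are independent and uniform. -/
theorem measurePreserving_relPos {n : ℕ} (i : Fin n) :
    MeasurePreserving (relPos i) (volume : Measure (Fin n → UnitAddCircle)) volume := by
  let f : (Fin n → UnitAddCircle) →+ (Fin n → UnitAddCircle) :=
    { toFun := relPos i
      map_zero' := by ext j; simp [relPos]
      map_add' := by
        intro x y
        ext j
        simp only [relPos, Pi.add_apply]
        split_ifs
        · rfl
        · abel }
  have : MeasurePreserving f (volume : Measure (Fin n → UnitAddCircle)) volume := by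
    refine AddMonoidHom.measurePreserving ?_ ?_ rfl
    · refine continuous_pi fun j => ?_
      change Continuous fun x : Fin n → UnitAddCircle => relPos i x j
      unfold relPos
      split_ifs <;> fun_prop
    · intro x
      refine ⟨fun j => if j = i then x i else x j + x i, funext fun j => ?_⟩
      change relPos i (fun j => if j = i then x i else x j + x i) j = x j
      unfold relPos
      by_cases h : j = i
      · simp [h]
      · simp [h]
  exact this

theorem iIndepFun_relPos {n : ℕ} (i : Fin n) :
    iIndepFun (fun j x => relPos i x j) (volume : Measure (Fin n → UnitAddCircle)) := by
  have h1 : iIndepFun (fun (j : Fin n) (x : Fin n → UnitAddCircle) => x j)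
      (volume : Measure (Fin n → UnitAddCircle)) :=
    iIndepFun_pi (X := fun _ x => x) fun _ => aemeasurable_id
  have hmp := measurePreserving_relPos i
  rw [iIndepFun_iff_map_fun_eq_pi_map fun j => (measurable_pi_apply j).aemeasurable] at h1
  have hm : ∀ j, AEMeasurable (fun x => relPos i x j) (volume : Measure (Fin n → UnitAddCircle)) :=
    fun j => ((measurable_pi_apply j).comp hmp.measurable).aemeasurable
  rw [iIndepFun_iff_map_fun_eq_pi_map hm]
  have e : ∀ j, (volume : Measure (Fin n → UnitAddCircle)).map (fun x => relPos i x j)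
      = (volume : Measure (Fin n → UnitAddCircle)).map (fun x => x j) := by
    intro j
    conv_rhs => rw [← hmp.map_eq]
    rw [Measure.map_map (measurable_pi_apply j) hmp.measurable]
    rfl
  simp only [e]
  rw [← h1]
  conv_rhs => rw [← hmp.map_eq]
  rw [Measure.map_map (by fun_prop) hmp.measurable]
  rfl

theorem map_relPos {n : ℕ} (i j : Fin n) :
    MeasurePreserving (fun x => relPos i x j) (volume : Measure (Fin n → UnitAddCircle)) volume :=
  (measurePreserving_eval (fun _ : Fin n => (volume : Measure UnitAddCircle)) j).comp (measurePreserving_relPos i)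

theorem map_relPos_pair {n : ℕ} (i : Fin n) {j k : Fin n} (hjk : j ≠ k) :
    MeasurePreserving (fun x => (relPos i x j, relPos i x k))
      (volume : Measure (Fin n → UnitAddCircle)) volume := by
  have h := (iIndepFun_relPos i).indepFun hjk
  rw [indepFun_iff_map_prod_eq_prod_map_map (map_relPos i j).measurable.aemeasurable
    (map_relPos i k).measurable.aemeasurable, (map_relPos i j).map_eq, (map_relPos i k).map_eq] at h
  exact ⟨(map_relPos i j).measurable.prodMk (map_relPos i k).measurable, h⟩

end Circle

/-! ### The block model on the circle and its expected counts -/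

section Model

/-- The connection radius between the vertices `i` and `j`. -/
noncomputable def radius {n : ℕ} (rs rd : ℝ) (V : Finset (Fin n)) (i j : Fin n) : ℝ :=
  rd + (rs - rd) * (if (i ∈ V ↔ j ∈ V) then 1 else 0)

theorem radius_comm {n : ℕ} (rs rd : ℝ) (V : Finset (Fin n)) (i j : Fin n) :
    radius rs rd V i j = radius rs rd V j i := by
  simp only [radius, iff_comm (a := j ∈ V)]

theorem radius_of_same {n : ℕ} {rs rd : ℝ} {V : Finset (Fin n)} {i j : Fin n}
    (h : i ∈ V ↔ j ∈ V) : radius rs rd V i j = rs := by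
  rw [radius, if_pos h]; ring

theorem radius_of_not_same {n : ℕ} {rs rd : ℝ} {V : Finset (Fin n)} {i j : Fin n}
    (h : ¬ (i ∈ V ↔ j ∈ V)) : radius rs rd V i j = rd := by
  rw [radius, if_neg h]; ring

theorem radius_eq_or {n : ℕ} (rs rd : ℝ) (V : Finset (Fin n)) (i j : Fin n) :
    radius rs rd V i j = rs ∨ radius rs rd V i j = rd := by
  by_cases h : i ∈ V ↔ j ∈ V
  · exact Or.inl (radius_of_same h)
  · exact Or.inr (radius_of_not_same h)

/-- The geometric block model with positions on the circle. -/
def circleGraph {n : ℕ} (rs rd : ℝ) (V : Finset (Fin n)) (y : Fin n → UnitAddCircle) :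
    SimpleGraph (Fin n) where
  Adj i j := i ≠ j ∧ ‖y i - y j‖ ≤ radius rs rd V i j
  symm := ⟨fun i j h => ⟨h.1.symm, by rw [norm_sub_rev, radius_comm]; exact h.2⟩⟩
  loopless := ⟨fun _ h => h.1 rfl⟩

theorem gbmGraph_eq_circleGraph {n : ℕ} (rs rd : ℝ) (V : Finset (Fin n)) {x : Fin n → ℝ}
    (hx : ∀ i, x i ∈ Set.Icc (0 : ℝ) 1) :
    gbmGraph rs rd V x = circleGraph rs rd V fun i => (x i : UnitAddCircle) := by
  ext i j
  change (i ≠ j ∧ circDist (x i) (x j) ≤ radius rs rd V i j) ↔ _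
  rw [circDist_eq_norm (hx i) (hx j)]
  rfl

/-- The indicator that a relative position is within reach. -/
noncomputable def nearInd (r : ℝ) : UnitAddCircle → ℝ :=
  Set.indicator {z | ‖z‖ ≤ r} 1

/-- The indicator that two relative positions complete a triangle with the origin. -/
noncomputable def triangleInd (a b c : ℝ) : UnitAddCircle × UnitAddCircle → ℝ :=
  Set.indicator {p | ‖p.1‖ ≤ a ∧ ‖p.2‖ ≤ b ∧ ‖p.1 - p.2‖ ≤ c} 1

theorem measurableSet_near (r : ℝ) : MeasurableSet {z : UnitAddCircle | ‖z‖ ≤ r} :=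
  measurableSet_le (by fun_prop) (by fun_prop)

theorem measurable_nearInd (r : ℝ) : Measurable (nearInd r) :=
  measurable_one.indicator (measurableSet_near r)

theorem measurable_triangleInd (a b c : ℝ) : Measurable (triangleInd a b c) :=
  measurable_one.indicator (measurableSet_triangle a b c)

theorem nearInd_nonneg (r : ℝ) (z : UnitAddCircle) : 0 ≤ nearInd r z :=
  Set.indicator_nonneg (fun _ _ => zero_le_one) _

theorem nearInd_le_one (r : ℝ) (z : UnitAddCircle) : nearInd r z ≤ 1 :=
  Set.indicator_le_self' (fun _ _ => zero_le_one) _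

theorem triangleInd_nonneg (a b c : ℝ) (p : UnitAddCircle × UnitAddCircle) :
    0 ≤ triangleInd a b c p :=
  Set.indicator_nonneg (fun _ _ => zero_le_one) _

theorem triangleInd_eq (a b c : ℝ) (p : UnitAddCircle × UnitAddCircle) :
    triangleInd a b c p = nearInd a p.1 * nearInd b p.2 * nearInd c (p.1 - p.2) := by
  unfold triangleInd nearInd
  by_cases h1 : ‖p.1‖ ≤ a <;> by_cases h2 : ‖p.2‖ ≤ b <;> by_cases h3 : ‖p.1 - p.2‖ ≤ c <;>
    simp [h1, h2, h3]

theorem triangleInd_le (a b c : ℝ) (p : UnitAddCircle × UnitAddCircle) :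
    triangleInd a b c p ≤ nearInd a p.1 * nearInd b p.2 := by
  rw [triangleInd_eq]
  exact mul_le_of_le_one_right (mul_nonneg (nearInd_nonneg ..) (nearInd_nonneg ..))
    (nearInd_le_one ..)

theorem nearInd_neg (r : ℝ) (z : UnitAddCircle) : nearInd r (-z) = nearInd r z := by
  simp [nearInd, Set.indicator_apply]

variable {n : ℕ} (rs rd : ℝ) (V : Finset (Fin n))

theorem adjInd_circleGraph (y : Fin n → UnitAddCircle) {i j : Fin n} (h : i ≠ j) :
    adjInd (circleGraph rs rd V y) i j = nearInd (radius rs rd V i j) (y i - y j) := by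
  by_cases h2 : ‖y i - y j‖ ≤ radius rs rd V i j
  · have : (circleGraph rs rd V y).Adj i j := ⟨h, h2⟩
    simp [adjInd, nearInd, this, h2]
  · have : ¬ (circleGraph rs rd V y).Adj i j := fun h3 => h2 h3.2
    simp [adjInd, nearInd, this, h2]

theorem realDegree_circleGraph (y : Fin n → UnitAddCircle) (i : Fin n) :
    realDegree (circleGraph rs rd V y) i
      = ∑ j ∈ Finset.univ.erase i, nearInd (radius rs rd V i j) (relPos i y j) := by
  refine Finset.sum_congr rfl fun j hj => ?_
  have hj := Finset.ne_of_mem_erase hj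
  rw [adjInd_circleGraph _ _ _ _ hj.symm, relPos, if_neg hj, ← nearInd_neg, neg_sub]

theorem triangleCount_circleGraph (y : Fin n → UnitAddCircle) (i : Fin n) :
    triangleCount (circleGraph rs rd V y) i
      = ∑ p ∈ (Finset.univ.erase i).offDiag, triangleInd (radius rs rd V i p.1)
          (radius rs rd V i p.2) (radius rs rd V p.1 p.2) (relPos i y p.1, relPos i y p.2) := by
  refine Finset.sum_congr rfl fun p hp => ?_
  obtain ⟨h1, h2, h3⟩ := Finset.mem_offDiag.1 hp
  have h1 := Finset.ne_of_mem_erase h1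
  have h2 := Finset.ne_of_mem_erase h2
  rw [adjInd_circleGraph _ _ _ _ h1.symm, adjInd_circleGraph _ _ _ _ h2.symm,
    adjInd_circleGraph _ _ _ _ h3, triangleInd_eq, relPos, relPos, if_neg h1, if_neg h2,
    sub_sub_sub_cancel_right, ← nearInd_neg _ (y i - y p.1), ← nearInd_neg _ (y i - y p.2),
    neg_sub, neg_sub]

theorem measurable_realDegree (i : Fin n) :
    Measurable fun y => realDegree (circleGraph rs rd V y) i := by
  simp only [realDegree_circleGraph]
  exact Finset.measurable_fun_sum _ fun j _ =>
    (measurable_nearInd _).comp (map_relPos i j).measurable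

theorem measurable_triangleCount (i : Fin n) :
    Measurable fun y => triangleCount (circleGraph rs rd V y) i := by
  simp only [triangleCount_circleGraph]
  exact Finset.measurable_fun_sum _ fun p _ => (measurable_triangleInd ..).comp
    ((map_relPos i p.1).measurable.prodMk (map_relPos i p.2).measurable)

theorem measurable_localClustering (i : Fin n) :
    Measurable fun y => localClustering (circleGraph rs rd V y) i := by
  simp only [localClustering_eq_div]
  exact (measurable_triangleCount rs rd V i).div ((measurable_realDegree rs rd V i).mul
    ((measurable_realDegree rs rd V i).sub_const 1))

theorem integral_nearInd {r : ℝ} (h0 : 0 ≤ r) (h : r ≤ 1 / 2) (i j : Fin n) :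
    ∫ y, nearInd r (relPos i y j) = 2 * r := by
  have h1 := integral_map (μ := (volume : Measure (Fin n → UnitAddCircle)))
    (map_relPos i j).measurable.aemeasurable (measurable_nearInd r).aestronglyMeasurable
  rw [← h1, (map_relPos i j).map_eq, nearInd,
    integral_indicator_one (measurableSet_near r), measure_norm_le h0 h]

theorem integral_triangleInd (a b c : ℝ) (i : Fin n) {j k : Fin n} (hjk : j ≠ k) :
    ∫ y, triangleInd a b c (relPos i y j, relPos i y k) = triangleProb a b c := by
  have h := integral_map (μ := (volume : Measure (Fin n → UnitAddCircle)))
    (map_relPos_pair i hjk).measurable.aemeasurable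
    (measurable_triangleInd a b c).aestronglyMeasurable
  rw [← h, (map_relPos_pair i hjk).map_eq, triangleInd,
    integral_indicator_one (measurableSet_triangle a b c), triangleProb]

/-- The number of vertices in the community of `i`. -/
def communitySize (V : Finset (Fin n)) (i : Fin n) : ℕ :=
  (Finset.univ.filter fun j => (i ∈ V ↔ j ∈ V)).card

theorem sum_same_community (i : Fin n) :
    ∑ j ∈ Finset.univ.erase i, (if (i ∈ V ↔ j ∈ V) then (1 : ℝ) else 0)
      = communitySize V i - 1 := by
  rw [Finset.sum_erase_eq_sub (Finset.mem_univ i), Finset.sum_boole, if_pos Iff.rfl, communitySize]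

theorem one_le_communitySize (i : Fin n) : 1 ≤ communitySize V i :=
  Finset.card_pos.2 ⟨i, by simp⟩

theorem communitySize_le (i : Fin n) : communitySize V i ≤ n := by
  simpa [communitySize] using Finset.card_filter_le (Finset.univ : Finset (Fin n)) fun j => (i ∈ V ↔ j ∈ V)

theorem card_univ_erase (i : Fin n) : ((Finset.univ.erase i).card : ℝ) = n - 1 := by
  rw [Finset.card_erase_of_mem (Finset.mem_univ i), Finset.card_univ, Fintype.card_fin,
    Nat.cast_sub i.pos, Nat.cast_one]

theorem integral_realDegree {lam b : ℝ} (hl : 1 ≤ lam) (hb : 0 ≤ b) (hlb : lam * b ≤ 1 / 3)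
    (i : Fin n) : ∫ y, realDegree (circleGraph (lam * b) b V y) i
      = 2 * b * (lam * (communitySize V i - 1) + (n - communitySize V i)) := by
  have hb3 : b ≤ 1 / 3 := by nlinarith
  have hr : ∀ j, 0 ≤ radius (lam * b) b V i j ∧ radius (lam * b) b V i j ≤ 1 / 2 := by
    intro j
    rcases radius_eq_or (lam * b) b V i j with h | h <;> rw [h]
    · exact ⟨by positivity, by linarith⟩
    · exact ⟨hb, by linarith⟩
  simp only [realDegree_circleGraph]
  rw [integral_finsetSum]
  · rw [Finset.sum_congr rfl fun j _ => integral_nearInd (hr j).1 (hr j).2 i j]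
    simp only [radius]
    rw [← Finset.mul_sum, Finset.sum_add_distrib, ← Finset.mul_sum, sum_same_community,
      Finset.sum_const, nsmul_eq_mul, card_univ_erase]
    ring
  · exact fun j _ => integrable_of_bounded
      ((measurable_nearInd _).comp (map_relPos i j).measurable) (C := 1) fun y => by
        rw [abs_of_nonneg (nearInd_nonneg ..)]; exact nearInd_le_one ..

/-- With two communities, three vertices either all agree or have exactly one agreeing pair. The
symmetries of `triangleProb` move that pair's radius to the first argument. -/
theorem triangleProb_radius {lam b : ℝ} (hl : 1 ≤ lam) (hb : 0 ≤ b) (hlb : lam * b ≤ 1 / 3)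
    (i j k : Fin n) :
    triangleProb (radius (lam * b) b V i j) (radius (lam * b) b V i k) (radius (lam * b) b V j k)
      = b ^ 2 * ((3 * lam ^ 2 - mixedCoeff lam) * ((if (i ∈ V ↔ j ∈ V) then 1 else 0) *
        (if (i ∈ V ↔ k ∈ V) then 1 else 0)) + mixedCoeff lam) := by
  have hs := triangleProb_scaled hl hb hlb
  by_cases hj : i ∈ V ↔ j ∈ V <;> by_cases hk : i ∈ V ↔ k ∈ V
  · rw [radius_of_same hj, radius_of_same hk, radius_of_same (hj.symm.trans hk), if_pos hj,
      if_pos hk, triangleProb_equilateral (by positivity) hlb]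
    ring
  · have hjk : ¬ (j ∈ V ↔ k ∈ V) := by tauto
    rw [radius_of_same hj, radius_of_not_same hk, radius_of_not_same hjk, if_neg hk, hs]
    ring
  · have hjk : ¬ (j ∈ V ↔ k ∈ V) := by tauto
    rw [radius_of_not_same hj, radius_of_same hk, radius_of_not_same hjk, if_neg hj,
      triangleProb_swap, hs]
    ring
  · have hjk : j ∈ V ↔ k ∈ V := by tauto
    rw [radius_of_not_same hj, radius_of_not_same hk, radius_of_same hjk, if_neg hj,
      triangleProb_rotate, hs]
    ring

theorem integral_triangleCount {lam b : ℝ} (hl : 1 ≤ lam) (hb : 0 ≤ b) (hlb : lam * b ≤ 1 / 3)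
    (i : Fin n) : ∫ y, triangleCount (circleGraph (lam * b) b V y) i
      = b ^ 2 * ((3 * lam ^ 2 - mixedCoeff lam) *
          ((communitySize V i - 1) * (communitySize V i - 2))
        + mixedCoeff lam * ((n - 1) * (n - 2))) := by
  simp only [triangleCount_circleGraph]
  rw [integral_finsetSum]
  · rw [Finset.sum_congr rfl fun p hp => (integral_triangleInd _ _ _ i
      (Finset.mem_offDiag.1 hp).2.2).trans (triangleProb_radius V hl hb hlb i p.1 p.2),
      ← Finset.mul_sum, Finset.sum_add_distrib, ← Finset.mul_sum,
      sum_offDiag_mul (Finset.univ.erase i) fun j => if (i ∈ V ↔ j ∈ V) then (1 : ℝ) else 0,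
      Finset.sum_const, nsmul_eq_mul, Finset.offDiag_card,
      Nat.cast_sub (Nat.le_mul_self _), Nat.cast_mul, card_univ_erase, sum_same_community]
    have e : ∀ j, (if (i ∈ V ↔ j ∈ V) then (1 : ℝ) else 0) * (if (i ∈ V ↔ j ∈ V) then (1 : ℝ) else 0)
        = if (i ∈ V ↔ j ∈ V) then (1 : ℝ) else 0 := fun j => by split_ifs <;> norm_num
    rw [Finset.sum_congr rfl fun j _ => e j, sum_same_community]
    ring
  · exact fun p _ => integrable_of_bounded ((measurable_triangleInd ..).comp
      ((map_relPos i p.1).measurable.prodMk (map_relPos i p.2).measurable)) (C := 1) fun y => by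
        rw [abs_of_nonneg (triangleInd_nonneg ..)]
        exact (triangleInd_le ..).trans
          (mul_le_one₀ (nearInd_le_one ..) (nearInd_nonneg ..) (nearInd_le_one ..))

end Model

/-! ### Concentration of the local clustering coefficient -/

section Concentration

/-- The ratio of the expected triangle count to the squared expected degree, for a vertex whose
community has size `m`. -/
noncomputable def localMean (lam n m : ℝ) : ℝ :=
  ((3 * lam ^ 2 - mixedCoeff lam) * ((m - 1) * (m - 2)) + mixedCoeff lam * ((n - 1) * (n - 2))) /
    (4 * (lam * (m - 1) + (n - m)) ^ 2)

/-- A bound on the mean deviation of a local clustering coefficient, where `x = n r_d`. -/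
noncomputable def deviationBound (lam x : ℝ) : ℝ :=
  2 / x + 2 / √x + 4 * lam * √(2 + 2 * lam * x) / x

theorem tendsto_deviationBound (lam : ℝ) :
    Tendsto (deviationBound lam) atTop (𝓝 0) := by
  have h1 : Tendsto (fun x : ℝ => 2 / x) atTop (𝓝 0) := tendsto_const_nhds.div_atTop tendsto_id
  have h2 : Tendsto (fun x : ℝ => 2 / √x) atTop (𝓝 0) :=
    tendsto_const_nhds.div_atTop Real.tendsto_sqrt_atTop
  have h3 : Tendsto (fun x : ℝ => 4 * lam * √(2 + 2 * lam * x) / x) atTop (𝓝 0) := by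
    -- The factor 1/x is moved under the root as 1/x².
    have h4 : Tendsto (fun x : ℝ => 4 * lam * √(1 / x * (2 / x + 2 * lam))) atTop
        (𝓝 (4 * lam * √(0 * (0 + 2 * lam)))) :=
      (((tendsto_const_nhds.div_atTop tendsto_id).mul (h1.add_const _)).sqrt).const_mul _
    rw [zero_mul, Real.sqrt_zero, mul_zero] at h4
    refine h4.congr' ?_
    filter_upwards [eventually_gt_atTop 0] with x hx
    rw [mul_div_assoc]
    congr 1
    rw [eq_div_iff hx.ne']
    nth_rewrite 3 [← Real.sqrt_sq hx.le]
    rw [← Real.sqrt_mul' _ (sq_nonneg x)]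
    congr 1
    field_simp
  have := (h1.add h2).add h3
  simp only [add_zero] at this
  exact this

variable {n : ℕ} (V : Finset (Fin n))

theorem realDegree_le (G : SimpleGraph (Fin n)) (i : Fin n) : |realDegree G i| ≤ n := by
  rw [realDegree, abs_of_nonneg (Finset.sum_nonneg fun j _ => adjInd_nonneg G i j)]
  refine (Finset.sum_le_sum fun j _ => adjInd_le_one G i j).trans ?_
  rw [Finset.sum_const, nsmul_eq_mul, mul_one]
  exact_mod_cast (Finset.card_le_univ _).trans (Fintype.card_fin n).le

theorem triangleCount_abs_le (G : SimpleGraph (Fin n)) (i : Fin n) :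
    |triangleCount G i| ≤ n * (n + 1) := by
  rw [abs_of_nonneg (triangleCount_nonneg G i)]
  refine (triangleCount_le G i).trans ((le_abs_self _).trans ?_)
  rw [abs_mul]
  have h := realDegree_le G i
  refine mul_le_mul h ((abs_sub _ _).trans ?_) (abs_nonneg _) (Nat.cast_nonneg n)
  rw [abs_one]
  linarith

theorem variance_realDegree_le (rs rd : ℝ) (i : Fin n) :
    Var[fun y => realDegree (circleGraph rs rd V y) i; volume]
      ≤ ∫ y, realDegree (circleGraph rs rd V y) i := by
  simp only [realDegree_circleGraph]
  exact variance_sum_le_of_unit (iIndepFun_relPos i) (fun j => (map_relPos i j).measurable)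
    (fun j => measurable_nearInd _) (fun j => nearInd_nonneg _) (fun j => nearInd_le_one _) _

theorem variance_triangleCount_le {lam b : ℝ} (hl : 1 ≤ lam) (hb : 0 ≤ b)
    (hlb : lam * b ≤ 1 / 3) (i : Fin n) :
    Var[fun y => triangleCount (circleGraph (lam * b) b V y) i; volume]
      ≤ (2 * (2 * lam * (n * b))) ^ 2 * (2 + 2 * lam * (n * b)) := by
  have hbl : b ≤ lam * b := by nlinarith
  have hr : ∀ j, 0 ≤ radius (lam * b) b V i j ∧ radius (lam * b) b V i j ≤ lam * b := by
    intro j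
    rcases radius_eq_or (lam * b) b V i j with h | h <;> rw [h]
    · exact ⟨by positivity, le_rfl⟩
    · exact ⟨hb, hbl⟩
  simp only [triangleCount_circleGraph]
  refine (variance_sum_offDiag_le (iIndepFun_relPos i) (fun j => (map_relPos i j).measurable)
    (α := fun j => nearInd (radius (lam * b) b V i j))
    (β := fun p => triangleInd (radius (lam * b) b V i p.1) (radius (lam * b) b V i p.2)
      (radius (lam * b) b V p.1 p.2)) (fun j => measurable_nearInd _)
    (fun j => nearInd_nonneg _) (fun j => nearInd_le_one _) (fun p => measurable_triangleInd _ _ _)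
    (fun p => triangleInd_nonneg _ _ _) (fun p => triangleInd_le _ _ _) (r := 2 * (lam * b))
    (by positivity) (fun j => ?_) _).trans ?_
  · rw [integral_nearInd (hr j).1 (by linarith [(hr j).2])]
    linarith [(hr j).2]
  · rw [card_univ_erase]
    have h1 : (1 : ℝ) ≤ n := by exact_mod_cast i.pos
    have h2 : ((n : ℝ) - 1) * (2 * (lam * b)) ≤ 2 * lam * (n * b) := by
      have : 0 ≤ lam * b := by positivity
      nlinarith
    have h3 : 0 ≤ ((n : ℝ) - 1) * (2 * (lam * b)) :=
      mul_nonneg (by linarith) (by positivity)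
    calc _ = (2 * (((n : ℝ) - 1) * (2 * (lam * b)))) ^ 2
          * (2 + ((n : ℝ) - 1) * (2 * (lam * b))) := by ring
      _ ≤ _ := by gcongr

/-- Take expectations in `abs_localClustering_sub_le` with m = E d and t = E T. The two variance
bounds control the numerator, and E d ≥ n b makes the result independent of the vertex and of the
community sizes. -/
theorem integral_abs_localClustering_sub_le {lam b : ℝ} (hl : 1 ≤ lam) (hb : 0 < b)
    (hlb : lam * b ≤ 1 / 3) (hn : 2 ≤ n) (i : Fin n) :
    ∫ y, |localClustering (circleGraph (lam * b) b V y) i - localMean lam n (communitySize V i)|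
      ≤ deviationBound lam (n * b) := by
  set d : (Fin n → UnitAddCircle) → ℝ := fun y => realDegree (circleGraph (lam * b) b V y) i with hd
  set T : (Fin n → UnitAddCircle) → ℝ :=
    fun y => triangleCount (circleGraph (lam * b) b V y) i with hT
  set μ := ∫ y, d y with hμ
  set t := ∫ y, T y with ht
  set m : ℝ := (communitySize V i : ℝ)
  set x := (n : ℝ) * b with hx
  have hm1 : 1 ≤ m := Nat.one_le_cast.2 (one_le_communitySize V i)
  have hmn : m ≤ n := Nat.cast_le.2 (communitySize_le V i)
  have hn' : (2 : ℝ) ≤ n := by exact_mod_cast hn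
  have hx0 : 0 < x := by positivity
  have hμe : μ = 2 * b * (lam * (m - 1) + (n - m)) := integral_realDegree V hl hb.le hlb i
  have hte := integral_triangleCount V hl hb.le hlb i
  -- As λ ≥ 1, the mean degree is at least 2b(n − 1), which is at least nb once n ≥ 2.
  have hxμ : x ≤ μ := by
    rw [hμe, hx]
    have : (n : ℝ) - 1 ≤ lam * (m - 1) + (n - m) := by nlinarith
    nlinarith
  have hμ0 : 0 < μ := hx0.trans_le hxμ
  have hmean : localMean lam n m = t / μ ^ 2 := by
    rw [ht, hT, hte, hμe, localMean]
    have : 0 < lam * (m - 1) + (n - m) := by nlinarith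
    field_simp
    ring
  have hdm : Measurable d := measurable_realDegree _ _ _ _
  have hTm : Measurable T := measurable_triangleCount _ _ _ _
  have hdL : MemLp d 2 volume := memLp_two_of_bounded hdm fun y => realDegree_le _ i
  have hTL : MemLp T 2 volume := memLp_two_of_bounded hTm fun y => triangleCount_abs_le _ i
  have hdI : Integrable d volume := hdL.integrable (by norm_num)
  have hTI : Integrable T volume := hTL.integrable (by norm_num)
  have hvd : Var[d; volume] ≤ μ := variance_realDegree_le V _ _ i
  have hd1 : ∫ y, |d y - μ| ≤ √μ := integral_abs_sub_mean_le hdL hvd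
  have hd2 : ∫ y, (d y - μ) ^ 2 ≤ μ := by
    rwa [variance_eq_integral hdm.aemeasurable] at hvd
  have hT1 : ∫ y, |T y - t| ≤ 4 * lam * x * √(2 + 2 * lam * x) := by
    refine (integral_abs_sub_mean_le hTL (variance_triangleCount_le V hl hb.le hlb i)).trans ?_
    rw [Real.sqrt_mul (sq_nonneg _), Real.sqrt_sq (by positivity)]
    exact le_of_eq (by ring)
  have hsqI : Integrable (fun y => (d y - μ) ^ 2) volume :=
    (hdL.sub (memLp_const _)).integrable_sq
  have habsI : Integrable (fun y => |d y - μ|) volume := (hdI.sub (integrable_const _)).abs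
  have hTabsI : Integrable (fun y => |T y - t|) volume := (hTI.sub (integrable_const _)).abs
  have hbound : ∀ y, |localClustering (circleGraph (lam * b) b V y) i - localMean lam n m|
      ≤ ((d y - μ) ^ 2 + 2 * μ * |d y - μ| + d y + |T y - t|) / μ ^ 2 := by
    intro y
    rw [hmean]
    refine (abs_localClustering_sub_le _ i hμ0).trans ?_
    refine div_le_div_of_nonneg_right ?_ (sq_nonneg _)
    refine add_le_add ?_ le_rfl
    have e : realDegree (circleGraph (lam * b) b V y) i *
        (realDegree (circleGraph (lam * b) b V y) i - 1) - μ ^ 2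
        = (d y - μ) ^ 2 + 2 * μ * (d y - μ) - d y := by simp only [hd]; ring
    have hd0 : 0 ≤ d y := Finset.sum_nonneg fun j _ => adjInd_nonneg _ i j
    rw [e]
    refine (abs_sub _ _).trans (add_le_add ((abs_add_le _ _).trans ?_) (abs_of_nonneg hd0).le)
    rw [abs_mul, abs_of_nonneg (sq_nonneg _), abs_of_pos (by linarith : 0 < 2 * μ)]
  have hI1 : Integrable (fun y => (d y - μ) ^ 2 + 2 * μ * |d y - μ|) volume :=
    hsqI.add (habsI.const_mul (2 * μ))
  have hI2 : Integrable (fun y => (d y - μ) ^ 2 + 2 * μ * |d y - μ| + d y) volume := hI1.add hdI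
  have hI3 : Integrable (fun y => (d y - μ) ^ 2 + 2 * μ * |d y - μ| + d y + |T y - t|) volume :=
    hI2.add hTabsI
  have hE : ∫ y, ((d y - μ) ^ 2 + 2 * μ * |d y - μ| + d y + |T y - t|) / μ ^ 2
      = ((∫ y, (d y - μ) ^ 2) + 2 * μ * (∫ y, |d y - μ|) + μ + ∫ y, |T y - t|) / μ ^ 2 := by
    rw [integral_div, integral_add hI2 hTabsI, integral_add hI1 hdI,
      integral_add hsqI (habsI.const_mul (2 * μ)), integral_const_mul]
  calc _ ≤ ∫ y, ((d y - μ) ^ 2 + 2 * μ * |d y - μ| + d y + |T y - t|) / μ ^ 2 := by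
        refine integral_mono_of_nonneg (ae_of_all _ fun y => abs_nonneg _) (hI3.div_const _)
          (ae_of_all _ hbound)
    _ ≤ (μ + 2 * μ * √μ + μ + 4 * lam * x * √(2 + 2 * lam * x)) / μ ^ 2 := by
        rw [hE]; gcongr
    _ = 2 / μ + 2 / √μ + 4 * lam * x * √(2 + 2 * lam * x) / μ ^ 2 := by
        have hs : √μ ^ 2 = μ := Real.sq_sqrt hμ0.le
        have hs0 : 0 < √μ := Real.sqrt_pos.2 hμ0
        have e : 2 / √μ = 2 * μ * √μ / μ ^ 2 := by
          rw [div_eq_div_iff hs0.ne' (by positivity)]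
          linear_combination (-2 * μ) * hs
        rw [e]
        field_simp
        ring
    _ ≤ 2 / x + 2 / √x + 4 * lam * x * √(2 + 2 * lam * x) / x ^ 2 := by gcongr
    _ = deviationBound lam x := by
        rw [deviationBound]
        congr 1
        field_simp

end Concentration

/-! ### Averaging over vertices and passage to the limit -/

section Convergence

theorem tendsto_localMean {lam s : ℝ} (hl : 1 ≤ lam) (h0 : 0 ≤ s) {m : ℕ → ℝ}
    (hm : Tendsto (fun n : ℕ => m n / n) atTop (𝓝 s)) :
    Tendsto (fun n : ℕ => localMean lam n (m n)) atTop (𝓝 (localLim lam s)) := by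
  have he : Tendsto (fun n : ℕ => 1 / (n : ℝ)) atTop (𝓝 0) := tendsto_one_div_atTop_nhds_zero_nat
  have hden : 0 < lam * s + (1 - s) := by nlinarith
  have hlim : Tendsto (fun n : ℕ =>
      ((3 * lam ^ 2 - mixedCoeff lam) * ((m n / n - 1 / n) * (m n / n - 2 * (1 / n)))
        + mixedCoeff lam * ((1 - 1 / n) * (1 - 2 * (1 / n)))) /
      (4 * (lam * (m n / n - 1 / n) + (1 - m n / n)) ^ 2)) atTop
      (𝓝 (((3 * lam ^ 2 - mixedCoeff lam) * ((s - 0) * (s - 2 * 0))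
        + mixedCoeff lam * ((1 - 0) * (1 - 2 * 0))) / (4 * (lam * (s - 0) + (1 - s)) ^ 2))) := by
    refine Tendsto.div ?_ ?_ (by rw [sub_zero]; positivity)
    · exact (((hm.sub he).mul (hm.sub (he.const_mul 2))).const_mul _).add
        (((tendsto_const_nhds.sub he).mul (tendsto_const_nhds.sub (he.const_mul 2))).const_mul _)
    · exact ((((hm.sub he).const_mul lam).add (tendsto_const_nhds.sub hm)).pow 2).const_mul 4
  have e : localLim lam s = (((3 * lam ^ 2 - mixedCoeff lam) * ((s - 0) * (s - 2 * 0))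
      + mixedCoeff lam * ((1 - 0) * (1 - 2 * 0))) / (4 * (lam * (s - 0) + (1 - s)) ^ 2)) := by
    rw [localLim]; congr 1 <;> ring
  rw [e]
  refine hlim.congr' ?_
  filter_upwards [eventually_ge_atTop 1] with n hn
  have hn0 : (n : ℝ) ≠ 0 := by positivity
  rw [localMean, ← mul_div_mul_right _ _ (pow_ne_zero 2 hn0)]
  congr 1 <;> field_simp

theorem communitySize_eq {n : ℕ} (V : Finset (Fin n)) (i : Fin n) :
    (communitySize V i : ℝ) = if i ∈ V then (V.card : ℝ) else n - V.card := by
  rw [communitySize]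
  split_ifs with h
  · simp only [h, true_iff, Finset.filter_univ_mem]
  · simp only [h, false_iff, ← Finset.mem_compl, Finset.filter_univ_mem]
    rw [Finset.card_compl, Fintype.card_fin, Nat.cast_sub (by simpa using V.card_le_univ)]

theorem average_localMean {n : ℕ} (lam : ℝ) (V : Finset (Fin n)) :
    1 / (n : ℝ) * ∑ i, localMean lam n (communitySize V i)
      = V.card / n * localMean lam n V.card + (n - V.card) / n * localMean lam n (n - V.card) := by
  have e : ∀ i, localMean lam n (communitySize V i) = if i ∈ V then localMean lam n V.card
      else localMean lam n (n - V.card) := fun i => by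
    rw [communitySize_eq]; split_ifs <;> rfl
  simp only [e]
  rw [← Finset.sum_add_sum_compl V, Finset.sum_congr rfl fun i hi => if_pos hi,
    Finset.sum_congr rfl fun i hi => if_neg (Finset.mem_compl.1 hi), Finset.sum_const,
    Finset.sum_const, Finset.card_compl, Fintype.card_fin, nsmul_eq_mul, nsmul_eq_mul,
    Nat.cast_sub (by simpa using V.card_le_univ)]
  ring

theorem tendsto_average_localMean {lam τ : ℝ} (hl : 1 ≤ lam) (h0 : 0 ≤ τ) (h1 : τ ≤ 1)
    {V : (n : ℕ) → Finset (Fin n)} (hV : ∀ n : ℕ, |((V n).card : ℝ) - τ * n| ≤ 1 / 2) :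
    Tendsto (fun n : ℕ => 1 / (n : ℝ) * ∑ i, localMean lam n (communitySize (V n) i)) atTop
      (𝓝 (hLim lam τ)) := by
  have hx : Tendsto (fun n : ℕ => ((V n).card : ℝ) / n) atTop (𝓝 τ) := by
    rw [tendsto_iff_norm_sub_tendsto_zero]
    have hlim : Tendsto (fun n : ℕ => 1 / 2 * (1 / (n : ℝ))) atTop (𝓝 (1 / 2 * 0)) :=
      tendsto_one_div_atTop_nhds_zero_nat.const_mul _
    rw [mul_zero] at hlim
    refine squeeze_zero' (Eventually.of_forall fun n => norm_nonneg _) ?_ hlim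
    filter_upwards [eventually_ge_atTop 1] with n hn
    have hn0 : (0 : ℝ) < n := by positivity
    have e : ((V n).card : ℝ) / n - τ = (((V n).card : ℝ) - τ * n) / n := by field_simp
    rw [e, Real.norm_eq_abs, abs_div, abs_of_pos hn0, mul_one_div]
    exact div_le_div_of_nonneg_right (hV n) hn0.le
  have hy : Tendsto (fun n : ℕ => ((n : ℝ) - (V n).card) / n) atTop (𝓝 (1 - τ)) := by
    refine (tendsto_const_nhds.sub hx).congr' ?_
    filter_upwards [eventually_ge_atTop 1] with n hn
    have hn0 : (n : ℝ) ≠ 0 := by positivity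
    field_simp
  -- The endpoints τ = 0, 1 need no separate treatment: `localLim` has denominator at least 4 on
  -- [0,1], so the factor of a vanishing community still converges while its weight tends to 0.
  simp only [average_localMean]
  rw [hLim_eq]
  exact (hx.mul (tendsto_localMean hl h0 hx)).add
    (hy.mul (tendsto_localMean hl (by linarith) hy))

/-- Only the triangle inequality and linearity of the integral enter, so the dependence between
local coefficients at different vertices is harmless. -/
theorem integral_abs_avgClustering_sub_le {n : ℕ} {lam b : ℝ} (hl : 1 ≤ lam) (hb : 0 < b)
    (hlb : lam * b ≤ 1 / 3) (hn : 2 ≤ n) (V : Finset (Fin n)) (c : ℝ) :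
    ∫ y, |avgClustering (circleGraph (lam * b) b V y) - c|
      ≤ deviationBound lam (n * b)
        + |1 / (n : ℝ) * ∑ i, localMean lam n (communitySize V i) - c| := by
  have hn0 : (0 : ℝ) < n := by positivity
  have hI : ∀ i, Integrable (fun y => |localClustering (circleGraph (lam * b) b V y) i
      - localMean lam n (communitySize V i)|) volume := fun i =>
    ((integrable_of_bounded (measurable_localClustering _ _ _ i) (C := 1) fun y => by
      rw [abs_of_nonneg (localClustering_mem _ i).1]
      exact (localClustering_mem _ i).2).sub (integrable_const _)).abs
  have hS := (integrable_finsetSum Finset.univ fun i _ => hI i).const_mul (1 / (n : ℝ))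
  calc _ ≤ ∫ y, (1 / (n : ℝ) * ∑ i, |localClustering (circleGraph (lam * b) b V y) i
        - localMean lam n (communitySize V i)|
        + |1 / (n : ℝ) * ∑ i, localMean lam n (communitySize V i) - c|) := by
        refine integral_mono_of_nonneg (ae_of_all _ fun y => abs_nonneg _)
          (hS.add (integrable_const _)) (ae_of_all _ fun y => ?_)
        simp only [avgClustering_eq]
        refine (abs_sub_le _ (1 / (n : ℝ) * ∑ i, localMean lam n (communitySize V i)) _).trans ?_
        refine add_le_add ?_ le_rfl
        rw [← mul_sub, ← Finset.sum_sub_distrib, abs_mul, abs_of_pos (one_div_pos.2 hn0)]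
        exact mul_le_mul_of_nonneg_left (Finset.abs_sum_le_sum_abs _ _) (one_div_pos.2 hn0).le
    _ = 1 / (n : ℝ) * ∑ i, (∫ y, |localClustering (circleGraph (lam * b) b V y) i
        - localMean lam n (communitySize V i)|)
        + |1 / (n : ℝ) * ∑ i, localMean lam n (communitySize V i) - c| := by
        rw [integral_add hS (integrable_const _), integral_const_mul,
          integral_finsetSum _ fun i _ => hI i, integral_const, probReal_univ, one_smul]
    _ ≤ 1 / (n : ℝ) * ∑ _i : Fin n, deviationBound lam (n * b)
        + |1 / (n : ℝ) * ∑ i, localMean lam n (communitySize V i) - c| := by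
        gcongr with i
        exact integral_abs_localClustering_sub_le V hl hb hlb hn i
    _ = _ := by
        rw [Finset.sum_const, Finset.card_univ, Fintype.card_fin, nsmul_eq_mul, ← mul_assoc,
          one_div_mul_cancel hn0.ne', one_mul]

theorem measurePreserving_coe_of_uniform {Ω : Type*} [MeasurableSpace Ω] {P : Measure Ω}
    [IsProbabilityMeasure P] {n : ℕ} {X : Fin n → Ω → ℝ} (hm : ∀ i, Measurable (X i))
    (hu : ∀ i, pdf.IsUniform (X i) (Set.Icc (0 : ℝ) 1) P volume) (hi : iIndepFun X P) :
    MeasurePreserving (fun ω i => (X i ω : UnitAddCircle)) P volume := by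
  have hc : Measurable fun x : ℝ => (x : UnitAddCircle) := AddCircle.measurable_mk'
  have hmap : ∀ i, P.map (fun ω => (X i ω : UnitAddCircle)) = volume := by
    intro i
    have h1 := hu i
    rw [pdf.IsUniform, ProbabilityTheory.cond, Real.volume_Icc, sub_zero, ENNReal.ofReal_one,
      inv_one, one_smul, ← restrict_Ioc_eq_restrict_Icc] at h1
    have h2 := (UnitAddCircle.measurePreserving_mk 0).map_eq
    rw [zero_add, ← h1, Measure.map_map hc (hm i)] at h2
    exact h2
  have h := hi.comp (fun _ x => (x : UnitAddCircle)) fun _ => hc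
  rw [iIndepFun_iff_map_fun_eq_pi_map fun i => (hc.comp (hm i)).aemeasurable] at h
  refine ⟨measurable_pi_lambda _ fun i => hc.comp (hm i), h.trans ?_⟩
  rw [volume_pi]
  congr 1
  exact funext hmap

theorem ae_mem_Icc_of_uniform {Ω : Type*} [MeasurableSpace Ω] {P : Measure Ω}
    {X : Ω → ℝ} (hm : Measurable X) (hu : pdf.IsUniform X (Set.Icc (0 : ℝ) 1) P volume) :
    ∀ᵐ ω ∂P, X ω ∈ Set.Icc (0 : ℝ) 1 := by
  refine ae_of_ae_map hm.aemeasurable ?_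
  rw [pdf.IsUniform] at hu
  rw [hu]
  exact ae_cond_mem measurableSet_Icc

/-- Markov's inequality, applied on the torus after transporting the joint law of the positions to
Haar measure. -/
theorem measure_deviation_le {Ω : Type*} [MeasurableSpace Ω] {P : Measure Ω}
    [IsProbabilityMeasure P] {n : ℕ} {X : Fin n → Ω → ℝ} (hm : ∀ i, Measurable (X i))
    (hu : ∀ i, pdf.IsUniform (X i) (Set.Icc (0 : ℝ) 1) P volume) (hi : iIndepFun X P)
    (rs rd : ℝ) (V : Finset (Fin n)) (c : ℝ) {ε : ℝ} (hε : 0 < ε) :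
    P {ω | ε ≤ |avgClustering (gbmGraph rs rd V fun i => X i ω) - c|}
      ≤ ENNReal.ofReal ((∫ y, |avgClustering (circleGraph rs rd V y) - c|) / ε) := by
  have hmeas : Measurable fun y => |avgClustering (circleGraph rs rd V y) - c| := by
    simp only [avgClustering_eq]
    exact (((Finset.measurable_fun_sum _ fun i _ =>
      measurable_localClustering rs rd V i).const_mul _).sub_const c).abs
  have hI : Integrable (fun y => |avgClustering (circleGraph rs rd V y) - c|) volume := by
    simp only [avgClustering_eq]
    exact (((integrable_finsetSum _ fun i _ => integrable_of_bounded
      (measurable_localClustering rs rd V i) (C := 1) fun y => by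
        rw [abs_of_nonneg (localClustering_mem _ i).1]
        exact (localClustering_mem _ i).2).const_mul _).sub (integrable_const c)).abs
  have hS : MeasurableSet {y | ε ≤ |avgClustering (circleGraph rs rd V y) - c|} :=
    measurableSet_le measurable_const hmeas
  have hae : ∀ᵐ ω ∂P, ∀ i, X i ω ∈ Set.Icc (0 : ℝ) 1 :=
    ae_all_iff.2 fun i => ae_mem_Icc_of_uniform (hm i) (hu i)
  have h1 : P {ω | ε ≤ |avgClustering (gbmGraph rs rd V fun i => X i ω) - c|}
      ≤ volume {y | ε ≤ |avgClustering (circleGraph rs rd V y) - c|} := by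
    rw [← (measurePreserving_coe_of_uniform hm hu hi).measure_preimage hS.nullMeasurableSet]
    -- The positions lie in [0,1] only almost surely, and the interval graph agrees with the circle
    -- graph there. An inequality suffices, so measurability of the event in Ω is not needed.
    refine measure_mono_ae ?_
    filter_upwards [hae] with ω hω
    intro h
    have h' : ε ≤ |avgClustering (gbmGraph rs rd V fun i => X i ω) - c| := h
    rw [gbmGraph_eq_circleGraph rs rd V hω] at h'
    exact h'
  refine h1.trans ?_
  have h2 := mul_meas_ge_le_integral_of_nonneg (ae_of_all _ fun y => abs_nonneg _) hI ε
  rw [← ofReal_measureReal]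
  refine ENNReal.ofReal_le_ofReal ?_
  rw [le_div_iff₀ hε, mul_comm]
  exact h2

end Convergence

theorem corollary4 :
    (∀ (lam τ : ℝ), 1 ≤ lam → 0 ≤ τ → τ ≤ 1 →
      -- threshold parameters, with `r_s = λ r_d`
      ∀ (rs rd : ℕ → ℝ),
      (∀ n, 0 ≤ rd n ∧ rd n ≤ rs n ∧ rs n ≤ 1 / 2) →
      (∀ n, rs n = lam * rd n) →
      Tendsto (fun n : ℕ => (n : ℝ) * rs n) atTop atTop →
      -- `r_s ≤ 1 / 3` for large `n`: three mutually adjacent points do not wind around the circle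
      (∀ᶠ n in atTop, rs n ≤ 1 / 3) →
      -- communities: `|V₁|` is `τ n`, or a nearest integer to it if it is not an integer
      ∀ (V₁ : (n : ℕ) → Finset (Fin n)),
      (∀ n : ℕ, |((V₁ n).card : ℝ) - τ * n| ≤ 1 / 2) →
      -- independent uniform positions
      ∀ (Ω : ℕ → Type*) [∀ n, MeasurableSpace (Ω n)]
        (P : (n : ℕ) → Measure (Ω n)) [∀ n, IsProbabilityMeasure (P n)]
        (X : (n : ℕ) → Fin n → Ω n → ℝ),
      (∀ n i, Measurable (X n i)) →
      (∀ n i, pdf.IsUniform (X n i) (Set.Icc (0 : ℝ) 1) (P n) volume) →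
      (∀ n, iIndepFun (X n) (P n)) →
      ∀ ε : ℝ, 0 < ε →
        Tendsto (fun n : ℕ => P n {ω | ε ≤
            |avgClustering (gbmGraph (rs n) (rd n) (V₁ n) (fun i => X n i ω)) - hLim lam τ|})
          atTop (𝓝 0)) ∧
    (∀ lam : ℝ, 1 < lam → {τ : ℝ | τ ∈ Set.Icc (0 : ℝ) 1 ∧ hLim lam τ = gLim lam τ}.Finite) := by
  refine ⟨?_, fun lam h => finite_hLim_eq_gLim h⟩
  intro lam τ hl h0 h1 rs rd hr hrs htop hthird V₁ hV Ω _ P _ X hm hu hi ε hε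
  have hl0 : 0 < lam := by linarith
  have hx : Tendsto (fun n : ℕ => (n : ℝ) * rd n) atTop atTop := by
    refine (htop.atTop_div_const hl0).congr fun n => ?_
    rw [hrs]
    field_simp
  have hlim : Tendsto (fun n : ℕ => ENNReal.ofReal ((deviationBound lam (n * rd n)
      + |1 / (n : ℝ) * ∑ i, localMean lam n (communitySize (V₁ n) i) - hLim lam τ|) / ε)) atTop
      (𝓝 0) := by
    have h2 := ((tendsto_average_localMean hl h0 h1 hV).sub_const (hLim lam τ)).abs
    rw [sub_self, abs_zero] at h2
    have h3 := ((((tendsto_deviationBound lam).comp hx).add h2).div_const ε)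
    rw [add_zero, zero_div] at h3
    simpa using ENNReal.tendsto_ofReal h3
  refine tendsto_of_tendsto_of_tendsto_of_le_of_le' tendsto_const_nhds hlim
    (Eventually.of_forall fun n => zero_le) ?_
  -- Divergence of n r_d also gives r_d > 0 for large n, which the L¹ estimate requires.
  filter_upwards [eventually_ge_atTop 2, hthird, hx.eventually_gt_atTop 0] with n hn h3 hpos
  have hb : 0 < rd n := pos_of_mul_pos_right hpos (Nat.cast_nonneg n)
  refine (measure_deviation_le (hm n) (hu n) (hi n) _ _ _ _ hε).trans ?_
  refine ENNReal.ofReal_le_ofReal (div_le_div_of_nonneg_right ?_ hε.le)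
  rw [hrs n] at h3 ⊢
  exact integral_abs_avgClustering_sub_le hl hb h3 hn _ _
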